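/- There are absolute constants $C,c>0$ such that the following holds. Let $(x,y)\sim\mathcal D$ be a random pair with $x$ in a separable real Hilbert space and $y\in\mathbb R$, with $\mathbb E\|x\|^4<\infty$ and $\mathbb E y^2<\infty$. Let $H=\mathbb E[xx^\top]$, with an orthonormal eigenbasis $(v_i)$ and eigenvalues $(\lambda_i)$, let $R(w)=\tfrac12\mathbb E(y-\langle w,x\rangle)^2$, let $w^*$ be a minimizer of $R$, and let $\Delta(w)=R(w)-R(w^*)$. For PSD $A$ write $\|u\|_A^2=\langle u,Au\rangle$; for an index set $K$ with complement $K^c$ and $a\ge0$ let $H_{K^c}=\sum_{i\notin K}\lambda_iv_iv_i^\top$ and $aI_K+H_{K^c}=\sum_{i\in K}a\,v_iv_i^\top+\sum_{i\notin K}\lambda_iv_iv_i^\top$. Assume that (A) for some $\alpha>0$, $\mathbb E[xx^\top Axx^\top]\preceq\alpha\,\mathrm{tr}(HA)H$ for every PSD operator $A$; and (N) for some $\sigma^2>0$, $\mathbb E[(y-\langle w^*,x\rangle)^2xx^\top]\preceq\sigma^2H$. Let $N>100$, $N_{\rm eff}=N/\log_2N$, $0<\gamma<1/(4\alpha\,\mathrm{tr}(H))$,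 and $\gamma_t=\gamma/2^{\lfloor t/N_{\rm eff}\rfloor}$ for $0\le t<N$. From a fixed $w_0$ and $N$ independent samples $(x_t,y_t)\sim\mathcal D$, run SGD, $w_t=w_{t-1}-\gamma_{t-1}(x_tx_t^\top w_{t-1}-x_ty_t)$, $t=1,\dots,N$. For an index set $K$ put $D_{\rm eff}(K)=|K|+N_{\rm eff}^2\gamma^2\sum_{i\notin K}\lambda_i^2$, and let $$U(K)=\Big\|\prod_{t=0}^{N-1}(I-\gamma_tH)(w_0-w^*)\Big\|_H^2+\Big(\alpha\|w_0-w^*\|^2_{\frac{I_K}{N_{\rm eff}\gamma}+H_{K^c}}+\sigma^2\Big)\frac{D_{\rm eff}(K)}{N_{\rm eff}} .$$ (1) For every index set $K$ (the bound being $+\infty$ if $K$ is infinite), $\ \mathbb E\,\Delta(w_N)\le C\,U(K)$. (2) Assume in addition that (B) for some $\beta>0$, $\mathbb E[xx^\top Axx^\top]-HAH\succeq\beta\,\mathrm{tr}(HA)H$ for every PSD operator $A$; and (N') $y=\langle w^*,x\rangle+\varepsilon$ with $\varepsilon\sim\mathcal N(0,\sigma^2)$ independent of $x$. Let $K^*=\{k:\lambda_k\ge1/(\gamma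 N_{\rm eff})\}$ and $$L=\Big\|\prod_{t=0}^{N-1}(I-\gamma_tH)(w_0-w^*)\Big\|_H^2+\Big(\beta\|w_0-w^*\|^2_{H_{(K^*)^c}}+\sigma^2\Big)\frac{D_{\rm eff}(K^*)}{N_{\rm eff}} .$$ Then $\mathbb E\,\Delta(w_N)\ge c\,L$. Moreover the two bounds match up to a constant factor when the signal-to-noise ratio is bounded: if $\|w_0-w^*\|_H^2\le R\,\sigma^2$, then $U(K^*)\le(1+\alpha R)\,L$. -/

import Mathlib

open MeasureTheory ProbabilityTheory
open scoped ENNReal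

noncomputable section

namespace TargetSGD

variable {E : Type*} [NormedAddCommGroup E] [InnerProductSpace ℝ E]

/-- The rank-one operator `x xᵀ`, i.e. `u ↦ ⟪x, u⟫ x`. -/
def outer (x : E) : E →L[ℝ] E := InnerProductSpace.rankOne ℝ x x

/-- The squared weighted seminorm `‖u‖²_A = uᵀ A u`. -/
def quad (A : E →L[ℝ] E) (u : E) : ℝ := inner ℝ u (A u)

/-- The trace of an operator, computed in the orthonormal basis `v`. -/
def opTrace {ι : Type*} (v : HilbertBasis ι ℝ E) (T : E →L[ℝ] E) : ℝ :=
  ∑' i, inner ℝ (v i) (T (v i))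

section Distribution

variable [MeasurableSpace E]

/-- The covariance matrix `H = 𝔼[x xᵀ]` of the covariate, for `(x, y) ∼ D`. -/
def cov (D : Measure (E × ℝ)) : E →L[ℝ] E := ∫ p, outer p.1 ∂D

/-- The risk `½ 𝔼 (y - ⟪w, x⟫)²`. -/
def risk (D : Measure (E × ℝ)) (w : E) : ℝ :=
  (1 / 2) * ∫ p, (p.2 - inner ℝ w p.1) ^ 2 ∂D

/-- The excess risk of `w` over the reference parameter `wstar`. -/
def excessRisk (D : Measure (E × ℝ)) (wstar w : E) : ℝ := risk D w - risk D wstar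

/-- The linear regression model: the covariate has a finite fourth moment (hence a covariance
matrix of finite trace), the response has a finite second moment (hence all risks are finite),
and `wstar` minimizes the risk. -/
structure Model (D : Measure (E × ℝ)) (wstar : E) : Prop where
  covariate : MemLp (fun p : E × ℝ => p.1) 4 D
  response : MemLp (fun p : E × ℝ => p.2) 2 D
  minimizer : ∀ w, risk D wstar ≤ risk D w

/-- Fourth moment condition, upper part: `𝔼[x xᵀ A x xᵀ] ⪯ α tr(H A) H` for every PSD `A`. -/
def FourthMomentUpper {ι : Type*} (D : Measure (E × ℝ)) (v : HilbertBasis ι ℝ E) (α : ℝ) : Prop :=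
  ∀ A : E →L[ℝ] E, A.IsPositive →
    ∫ p, outer p.1 ∘L A ∘L outer p.1 ∂D ≤ (α * opTrace v (cov D ∘L A)) • cov D

/-- Fourth moment condition, lower part:
`𝔼[x xᵀ A x xᵀ] - H A H ⪰ β tr(H A) H` for every PSD `A`. -/
def FourthMomentLower {ι : Type*} (D : Measure (E × ℝ)) (v : HilbertBasis ι ℝ E) (β : ℝ) : Prop :=
  ∀ A : E →L[ℝ] E, A.IsPositive →
    (β * opTrace v (cov D ∘L A)) • cov D ≤
      (∫ p, outer p.1 ∘L A ∘L outer p.1 ∂D) - cov D ∘L A ∘L cov D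

/-- Noise condition: `𝔼[(y - ⟪w*, x⟫)² x xᵀ]` exists and is `⪯ σ² H`. -/
def NoiseCondition (D : Measure (E × ℝ)) (wstar : E) (σ : ℝ) : Prop :=
  Integrable (fun p : E × ℝ => (p.2 - inner ℝ wstar p.1) ^ 2 • outer p.1) D ∧
    ∫ p, (p.2 - inner ℝ wstar p.1) ^ 2 • outer p.1 ∂D ≤ σ ^ 2 • cov D

/-- Well-specified noise: `y = ⟪w*, x⟫ + ε` with `ε ∼ N(0, σ²)` independent of `x`. -/
def WellSpecifiedNoise (D : Measure (E × ℝ)) (wstar : E) (σ : ℝ) : Prop :=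
  HasLaw (fun p : E × ℝ => p.2 - inner ℝ wstar p.1) (gaussianReal 0 (Real.toNNReal (σ ^ 2))) D ∧
    IndepFun (fun p : E × ℝ => p.1) (fun p : E × ℝ => p.2 - inner ℝ wstar p.1) D

end Distribution

/-- The effective number of samples `N / log₂ N`. -/
def effN (N : ℕ) : ℝ := N / Real.logb 2 N

/-- The stepsize at time `t < N`: initially `γ`, and halved after every `N / log₂ N` steps. -/
def stepsize (γ : ℝ) (N t : ℕ) : ℝ := γ / 2 ^ ⌊(t : ℝ) / effN N⌋₊

/-- The SGD iterates started at `w₀`, where `z t` is the sample used in step `t + 1`. -/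
def sgd (γ : ℝ) (N : ℕ) (w₀ : E) (z : ℕ → E × ℝ) : ℕ → E
  | 0 => w₀
  | t + 1 =>
      let w := sgd γ N w₀ z t
      w - stepsize γ N t • (inner ℝ (z t).1 w • (z t).1 - (z t).2 • (z t).1)

/-- The expected excess risk of the last SGD iterate, over the draw of the `N` samples `Z`.
The excess risk is nonnegative when `wstar` minimizes the risk, so that its expectation is the
Lebesgue integral. -/
def expectedExcessRisk [MeasurableSpace E] {Ω : Type*} [MeasurableSpace Ω] (P : Measure Ω)
    (D : Measure (E × ℝ)) (wstar : E) (γ : ℝ) (N : ℕ) (w₀ : E) (Z : ℕ → Ω → E × ℝ) : ℝ≥0∞ :=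
  ∫⁻ ω, ENNReal.ofReal (excessRisk D wstar (sgd γ N w₀ (fun t => Z t ω) N)) ∂P

/-- The product `∏_{t < N} (I - γ_t H)`. -/
def contraction (H : E →L[ℝ] E) (γ : ℝ) (N : ℕ) : E →L[ℝ] E :=
  ((List.range N).map (fun t => 1 - stepsize γ N t • H)).prod

/-- `‖u‖²_A` for the operator `A = ∑ i, a i • vᵢ vᵢᵀ` with nonnegative `a`. -/
def specNormSq {ι : Type*} (v : HilbertBasis ι ℝ E) (a : ι → ℝ) (u : E) : ℝ≥0∞ :=
  ∑' i, ENNReal.ofReal (a i * (inner ℝ (v i) u) ^ 2)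

open Classical in
/-- The eigenvalues of `a I_K + H_{Kᶜ}`, where `lam` lists the eigenvalues of `H`. -/
def splitWeights {ι : Type*} (lam : ι → ℝ) (K : Set ι) (a : ℝ) : ι → ℝ :=
  fun i => if i ∈ K then a else lam i

/-- The effective dimension `|K| + N_eff² γ² ∑_{i ∉ K} λᵢ²` (infinite if `K` is infinite). -/
def effDim {ι : Type*} (lam : ι → ℝ) (γ : ℝ) (N : ℕ) (K : Set ι) : ℝ≥0∞ :=
  (K.encard : ℝ≥0∞) +
    ENNReal.ofReal (effN N ^ 2 * γ ^ 2) * ∑' i : (Kᶜ : Set ι), ENNReal.ofReal (lam i ^ 2)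

/-- The index set `{k : λ_k ≥ 1 / (γ N_eff)}`. -/
def optSet {ι : Type*} (lam : ι → ℝ) (γ : ℝ) (N : ℕ) : Set ι :=
  {k | 1 / (γ * effN N) ≤ lam k}

/-- The upper rate
`‖∏(I - γ_t H) u‖²_H + (α ‖u‖²_{I_K / (N_eff γ) + H_{Kᶜ}} + σ²) D_eff / N_eff`. -/
def upperRate {ι : Type*} (H : E →L[ℝ] E) (v : HilbertBasis ι ℝ E) (lam : ι → ℝ) (α σ γ : ℝ)
    (N : ℕ) (u : E) (K : Set ι) : ℝ≥0∞ :=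
  ENNReal.ofReal (quad H (contraction H γ N u)) +
    (ENNReal.ofReal α * specNormSq v (splitWeights lam K (1 / (effN N * γ))) u +
      ENNReal.ofReal (σ ^ 2)) * (effDim lam γ N K / ENNReal.ofReal (effN N))

/-- The lower rate `‖∏(I - γ_t H) u‖²_H + (β ‖u‖²_{H_{Kᶜ}} + σ²) D_eff / N_eff`. -/
def lowerRate {ι : Type*} (H : E →L[ℝ] E) (v : HilbertBasis ι ℝ E) (lam : ι → ℝ) (β σ γ : ℝ)
    (N : ℕ) (u : E) (K : Set ι) : ℝ≥0∞ :=
  ENNReal.ofReal (quad H (contraction H γ N u)) +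
    (ENNReal.ofReal β * specNormSq v (splitWeights lam K 0) u +
      ENNReal.ofReal (σ ^ 2)) * (effDim lam γ N K / ENNReal.ofReal (effN N))

end TargetSGD

end

/-!
Write `s t i` for the second moment of the `i`-th coordinate of `w_t - w*` in the eigenbasis. One
step of SGD contracts it by `(1 - γ_t λ_i)²` and injects a noise of order
`γ_t² λ_i (α ∑ λ_j (s t j) + σ²)`, so the coordinates are coupled only through the current energy
`∑ λ_j (s t j)`, which is twice the expected excess risk. Unrolling a coordinate exhibits the bias
`‖∏(I - γ_t H) u‖²_H` and, for each step, a noise weighted by the square of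
`γ_t λ_i ∏_{r > t} (1 - γ_r λ_i)`. The squared weights sum to at most a constant times `1 / N_eff`
and to at most a constant times `N_eff γ² λ_i²`, which is where `D_eff / N_eff` comes from.

It remains to control the energy. For the upper bound, telescoping over the first phase, in which
the stepsize is constant, bounds the energy collected there by `‖w₀ - w*‖²` in the split norm plus
the noise that this energy itself generates; since `γ α tr H ≤ 1 / 4` the latter is absorbed. Hence
the energy is small at some time of the first phase, and the same absorption keeps it small from
then on. For the lower bound, directions outside `K*` are contracted only by a constant factor, so
their initial energy is present at every step. A direction in `K*` sees
`N_eff γ_t λ_i ∈ [1/2, 1]` at some time, because the stepsize is halved phase by phase, and the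
noise of the following phase survives.
-/

namespace TargetSGD

section Sequences

lemma prod_one_sub_mul_one_add_sum_le_one {κ : Type*} (S : Finset κ) {x : κ → ℝ}
    (h0 : ∀ i ∈ S, 0 ≤ x i) (h1 : ∀ i ∈ S, x i ≤ 1) :
    (∏ i ∈ S, (1 - x i)) * (1 + ∑ i ∈ S, x i) ≤ 1 := by
  have hprod : ∏ i ∈ S, (1 - x i) ≤ Real.exp (-∑ i ∈ S, x i) := by
    rw [← Finset.sum_neg_distrib, Real.exp_sum]
    exact Finset.prod_le_prod (fun i hi => sub_nonneg.2 (h1 i hi))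
      fun i _ => Real.one_sub_le_exp_neg (x i)
  have hsum : 1 + ∑ i ∈ S, x i ≤ Real.exp (∑ i ∈ S, x i) := by
    linarith [Real.add_one_le_exp (∑ i ∈ S, x i)]
  calc (∏ i ∈ S, (1 - x i)) * (1 + ∑ i ∈ S, x i)
      ≤ Real.exp (-∑ i ∈ S, x i) * Real.exp (∑ i ∈ S, x i) :=
        mul_le_mul hprod hsum (add_nonneg zero_le_one (Finset.sum_nonneg h0)) (Real.exp_pos _).le
    _ = 1 := by rw [← Real.exp_add, neg_add_cancel, Real.exp_zero]

lemma exp_neg_two_mul_sum_le_prod_one_sub {κ : Type*} (S : Finset κ) {x : κ → ℝ}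
    (h0 : ∀ i ∈ S, 0 ≤ x i) (h1 : ∀ i ∈ S, x i ≤ 1 / 2) :
    Real.exp (-(2 * ∑ i ∈ S, x i)) ≤ ∏ i ∈ S, (1 - x i) := by
  rw [Finset.mul_sum, ← Finset.sum_neg_distrib, Real.exp_sum]
  refine Finset.prod_le_prod (fun i _ => (Real.exp_pos _).le) fun i hi => ?_
  rw [Real.exp_neg]
  refine inv_le_of_inv_le₀ (by linarith [h1 i hi]) (le_trans ?_ (Real.add_one_le_exp (2 * x i)))
  rw [inv_le_iff_one_le_mul₀ (by linarith [h1 i hi])]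
  nlinarith [h0 i hi, h1 i hi]

lemma sum_Ico_le_of_halving {f : ℕ → ℝ} {k : ℕ} (hk : 0 < k) (h0 : ∀ t, 0 ≤ f t)
    (hf : Antitone f) (hhalf : ∀ t, f (t + k) ≤ f t / 2) (t n : ℕ) :
    ∑ r ∈ Finset.Ico t n, f r ≤ 2 * k * f t := by
  have block (a b : ℕ) (hab : b ≤ a + k) : ∑ r ∈ Finset.Ico a b, f r ≤ k * f a := by
    calc ∑ r ∈ Finset.Ico a b, f r ≤ (Finset.Ico a b).card • f a :=
          Finset.sum_le_card_nsmul _ _ _ fun r hr => hf (Finset.mem_Ico.1 hr).1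
      _ ≤ k * f a := by
          rw [Nat.card_Ico, nsmul_eq_mul]
          exact mul_le_mul_of_nonneg_right (by exact_mod_cast (by omega : b - a ≤ k)) (h0 a)
  induction hd : n - t using Nat.strong_induction_on generalizing t with
  | _ d ih =>
    rcases le_or_gt n (t + k) with hn | hn
    · linarith [block t n hn, mul_nonneg (Nat.cast_nonneg (α := ℝ) k) (h0 t)]
    · rw [← Finset.sum_Ico_consecutive f (Nat.le_add_right t k) hn.le]
      have htail := ih (n - (t + k)) (by omega) (t + k) rfl
      have hscale := mul_le_mul_of_nonneg_left (hhalf t) (by positivity : (0 : ℝ) ≤ 2 * k)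
      linarith [block t (t + k) le_rfl]

section Recurrence

variable {R : Type*} [CommSemiring R] {b c s : ℕ → R} {n : ℕ}

lemma unroll_succ (a : R) (b c : ℕ → R) (n : ℕ) :
    c n * ((∏ r ∈ Finset.Ico 0 n, c r) * a +
        ∑ t ∈ Finset.range n, (∏ r ∈ Finset.Ico (t + 1) n, c r) * b t) + b n =
      (∏ r ∈ Finset.Ico 0 (n + 1), c r) * a +
        ∑ t ∈ Finset.range (n + 1), (∏ r ∈ Finset.Ico (t + 1) (n + 1), c r) * b t := by
  have hsum : ∑ t ∈ Finset.range n, (∏ r ∈ Finset.Ico (t + 1) (n + 1), c r) * b t =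
      c n * ∑ t ∈ Finset.range n, (∏ r ∈ Finset.Ico (t + 1) n, c r) * b t := by
    rw [Finset.mul_sum]
    refine Finset.sum_congr rfl fun t ht => ?_
    rw [Finset.prod_Ico_succ_top (Finset.mem_range.1 ht)]
    ring
  rw [Finset.sum_range_succ, hsum, Finset.Ico_self, Finset.prod_empty,
    Finset.prod_Ico_succ_top n.zero_le]
  ring

variable [PartialOrder R] [IsOrderedRing R]

lemma le_unroll (hc : ∀ t, 0 ≤ c t) (h : ∀ t < n, s (t + 1) ≤ c t * s t + b t) :
    s n ≤ (∏ r ∈ Finset.Ico 0 n, c r) * s 0 +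
      ∑ t ∈ Finset.range n, (∏ r ∈ Finset.Ico (t + 1) n, c r) * b t := by
  induction n with
  | zero => simp
  | succ n ih =>
    rw [← unroll_succ]
    refine (h n n.lt_succ_self).trans ?_
    gcongr
    exacts [hc n, ih fun t ht => h t (ht.trans n.lt_succ_self)]

lemma unroll_le (hc : ∀ t, 0 ≤ c t) (h : ∀ t < n, c t * s t + b t ≤ s (t + 1)) :
    (∏ r ∈ Finset.Ico 0 n, c r) * s 0 +
      ∑ t ∈ Finset.range n, (∏ r ∈ Finset.Ico (t + 1) n, c r) * b t ≤ s n := by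
  induction n with
  | zero => simp
  | succ n ih =>
    rw [← unroll_succ]
    refine le_trans ?_ (h n n.lt_succ_self)
    gcongr
    exacts [hc n, ih fun t ht => h t (ht.trans n.lt_succ_self)]

end Recurrence

lemma mul_sum_le_of_contraction {s f : ℕ → ℝ} {x : ℝ} {m : ℕ} (hs : 0 ≤ s m)
    (h : ∀ t < m, s (t + 1) ≤ (1 - x) * s t + f t) :
    x * ∑ t ∈ Finset.range m, s t ≤ s 0 + ∑ t ∈ Finset.range m, f t := by
  have htelescope : ∑ t ∈ Finset.range m, x * s t ≤
      ∑ t ∈ Finset.range m, (s t - s (t + 1) + f t) :=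
    Finset.sum_le_sum fun t ht => by linarith [h t (Finset.mem_range.1 ht)]
  rw [Finset.sum_add_distrib, Finset.sum_range_sub', ← Finset.mul_sum] at htelescope
  linarith

/- The excess `max (s t - s 0) 0` over the initial value satisfies the same recursion and
starts from zero. -/
lemma mul_sum_le_mul_init_of_contraction {s f : ℕ → ℝ} {x : ℝ} {m : ℕ} (hx0 : 0 ≤ x)
    (hx1 : x ≤ 1) (h0 : 0 ≤ s 0) (hf : ∀ t, 0 ≤ f t)
    (h : ∀ t < m, s (t + 1) ≤ (1 - x) * s t + f t) :
    x * ∑ t ∈ Finset.range m, s t ≤ m * (x * s 0) + ∑ t ∈ Finset.range m, f t := by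
  have hexcess := mul_sum_le_of_contraction (s := fun t => max (s t - s 0) 0) (f := f) (x := x)
    (le_max_right _ _) fun t ht => by
      have hpos := mul_nonneg (sub_nonneg.2 hx1) (le_max_right (s t - s 0) 0)
      have hle := mul_le_mul_of_nonneg_left (le_max_left (s t - s 0) 0) (sub_nonneg.2 hx1)
      exact max_le (by linarith [h t ht, mul_nonneg hx0 h0]) (by linarith [hf t])
  have hsum : ∑ t ∈ Finset.range m, s t ≤
      m * s 0 + ∑ t ∈ Finset.range m, max (s t - s 0) 0 := by
    rw [← nsmul_eq_mul, ← Finset.card_range m, ← Finset.sum_const, Finset.card_range,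
      ← Finset.sum_add_distrib]
    exact Finset.sum_le_sum fun t _ => by linarith [le_max_left (s t - s 0) 0]
  simp only [sub_self, max_self, zero_add] at hexcess
  linarith [mul_le_mul_of_nonneg_left hsum hx0]

end Sequences

section Stepsize

variable {N : ℕ} {γ l : ℝ}

lemma effN_nonneg : 0 ≤ effN N :=
  div_nonneg N.cast_nonneg (div_nonneg (Real.log_natCast_nonneg N) (Real.log_nonneg one_le_two))

lemma one_le_logb (hN : 1 < N) : 1 ≤ Real.logb 2 N := by
  rw [Real.le_logb_iff_rpow_le one_lt_two (by positivity), Real.rpow_one]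
  exact_mod_cast hN

lemma effN_mul_logb (hN : 1 < N) : effN N * Real.logb 2 N = N :=
  div_mul_cancel₀ _ (by linarith [one_le_logb hN])

lemma one_le_effN (hN : 1 < N) : 1 ≤ effN N := by
  rw [effN, one_le_div (by linarith [one_le_logb hN]),
    Real.logb_le_iff_le_rpow one_lt_two (by positivity), Real.rpow_natCast]
  exact_mod_cast N.lt_two_pow_self.le

lemma effN_pos (hN : 1 < N) : 0 < effN N := zero_lt_one.trans_le (one_le_effN hN)

lemma effN_le (hN : 1 < N) : effN N ≤ N :=
  div_le_self N.cast_nonneg (one_le_logb hN)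

lemma floor_effN_pos (hN : 1 < N) : 0 < ⌊effN N⌋₊ := Nat.floor_pos.2 (one_le_effN hN)

lemma floor_effN_le : (⌊effN N⌋₊ : ℝ) ≤ effN N := Nat.floor_le effN_nonneg

lemma floor_effN_le_self (hN : 1 < N) : ⌊effN N⌋₊ ≤ N :=
  Nat.floor_le_of_le (effN_le hN)

lemma half_effN_le_floor (hN : 1 < N) : effN N / 2 ≤ ⌊effN N⌋₊ := by
  have hfloor : (1 : ℝ) ≤ ⌊effN N⌋₊ := by exact_mod_cast floor_effN_pos hN
  linarith [Nat.lt_floor_add_one (effN N)]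

lemma stepsize_nonneg (hγ : 0 ≤ γ) (t : ℕ) : 0 ≤ stepsize γ N t := by
  unfold stepsize; positivity

lemma stepsize_zero : stepsize γ N 0 = γ := by simp [stepsize]

lemma stepsize_antitone (hγ : 0 ≤ γ) : Antitone (stepsize γ N) := fun t r h => by
  have := effN_nonneg (N := N)
  unfold stepsize
  gcongr
  exact one_le_two

lemma stepsize_le (hγ : 0 ≤ γ) (t : ℕ) : stepsize γ N t ≤ γ :=
  (stepsize_antitone hγ t.zero_le).trans_eq stepsize_zero

lemma stepsize_mul_nonneg (hγ : 0 ≤ γ) (hl : 0 ≤ l) (t : ℕ) : 0 ≤ stepsize γ N t * l :=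
  mul_nonneg (stepsize_nonneg hγ t) hl

lemma stepsize_mul_le (hγ : 0 ≤ γ) (hl : 0 ≤ l) (t : ℕ) : stepsize γ N t * l ≤ γ * l :=
  mul_le_mul_of_nonneg_right (stepsize_le hγ t) hl

lemma stepsize_eq_of_lt_floor {t : ℕ} (ht : t < ⌊effN N⌋₊) : stepsize γ N t = γ := by
  have hlt : (t : ℝ) < effN N := Nat.lt_of_lt_floor ht
  have hfloor : ⌊(t : ℝ) / effN N⌋₊ = 0 :=
    Nat.floor_eq_zero.2 ((div_lt_one (t.cast_nonneg.trans_lt hlt)).2 hlt)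
  simp [stepsize, hfloor]

lemma half_stepsize_le (hγ : 0 ≤ γ) {r t : ℕ} (h : r ≤ t + ⌊effN N⌋₊) :
    stepsize γ N t / 2 ≤ stepsize γ N r := by
  have hn := effN_nonneg (N := N)
  have hcast : (r : ℝ) ≤ t + effN N :=
    (Nat.cast_le.2 h).trans (by push_cast; linarith [floor_effN_le (N := N)])
  have hdiv : (r : ℝ) / effN N ≤ t / effN N + 1 :=
    (div_le_div_of_nonneg_right hcast hn).trans
      (by rw [add_div]; gcongr; exact div_self_le_one _)
  have hfloor : ⌊(r : ℝ) / effN N⌋₊ ≤ ⌊(t : ℝ) / effN N⌋₊ + 1 :=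
    (Nat.floor_mono hdiv).trans_eq (Nat.floor_add_one (by positivity))
  unfold stepsize
  rw [div_div, ← pow_succ]
  gcongr
  exact one_le_two

lemma stepsize_add_ceil_le (hN : 1 < N) (hγ : 0 ≤ γ) (t : ℕ) :
    stepsize γ N (t + ⌈effN N⌉₊) ≤ stepsize γ N t / 2 := by
  have hn := effN_pos hN
  have hdiv : (t : ℝ) / effN N + 1 ≤ ((t + ⌈effN N⌉₊ : ℕ) : ℝ) / effN N := by
    rw [div_add_one hn.ne', Nat.cast_add]
    gcongr
    exact Nat.le_ceil _
  have hfloor : ⌊(t : ℝ) / effN N⌋₊ + 1 ≤ ⌊((t + ⌈effN N⌉₊ : ℕ) : ℝ) / effN N⌋₊ :=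
    (Nat.floor_add_one (by positivity)).symm.trans_le (Nat.floor_mono hdiv)
  unfold stepsize
  rw [div_div, ← pow_succ]
  gcongr
  exact one_le_two

/- The stepsize is halved about `log₂ N` times, hence ends at the order of `γ / N`. -/
lemma stepsize_le_of_le_add_floor (hN : 1 < N) (hγ : 0 ≤ γ) {t : ℕ} (ht : N ≤ t + ⌊effN N⌋₊) :
    stepsize γ N t ≤ 4 * γ / N := by
  have hn := effN_pos hN
  have hcast : (N : ℝ) ≤ t + ⌊effN N⌋₊ := by exact_mod_cast ht
  have hphase : Real.logb 2 N - 1 ≤ (t : ℝ) / effN N := by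
    rw [le_div_iff₀ hn]
    linarith [effN_mul_logb hN, floor_effN_le (N := N)]
  have hlog : Real.logb 2 N ≤ (⌊(t : ℝ) / effN N⌋₊ : ℝ) + 2 := by
    linarith [Nat.lt_floor_add_one ((t : ℝ) / effN N)]
  have hpow : (N : ℝ) ≤ 2 ^ ⌊(t : ℝ) / effN N⌋₊ * 4 := by
    rw [Real.logb_le_iff_le_rpow one_lt_two (by positivity), Real.rpow_add two_pos,
      Real.rpow_natCast] at hlog
    norm_num at hlog
    linarith
  unfold stepsize
  rw [div_le_div_iff₀ (by positivity) (by positivity)]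
  nlinarith

lemma effN_mul_stepsize_mul_le_of_late (hN : 1 < N) (hγ : 0 ≤ γ) (hl : 0 ≤ l) {t : ℕ}
    (ht : N ≤ t + ⌊effN N⌋₊) : effN N * (stepsize γ N t * l) ≤ 4 * (γ * l) := by
  have : (0 : ℝ) < N := by positivity
  calc effN N * (stepsize γ N t * l) ≤ N * (4 * γ / N * l) := by
        have := stepsize_nonneg (N := N) hγ t
        gcongr
        exacts [effN_le hN, stepsize_le_of_le_add_floor hN hγ ht]
    _ = 4 * (γ * l) := by field_simp

lemma sum_stepsize_Ico_le (hN : 1 < N) (hγ : 0 ≤ γ) (t : ℕ) :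
    ∑ r ∈ Finset.Ico t N, stepsize γ N r ≤ 4 * effN N * stepsize γ N t := by
  have hceil : (⌈effN N⌉₊ : ℝ) ≤ 2 * effN N := by
    linarith [Nat.ceil_lt_add_one (effN_nonneg (N := N)), one_le_effN hN]
  have hsum := sum_Ico_le_of_halving (Nat.ceil_pos.2 (effN_pos hN)) (stepsize_nonneg hγ)
    (stepsize_antitone (N := N) hγ) (stepsize_add_ceil_le hN hγ) t N
  nlinarith [stepsize_nonneg (N := N) hγ t]

lemma le_sum_stepsize_Ico (hN : 1 < N) (hγ : 0 ≤ γ) {t : ℕ} (ht : t + ⌊effN N⌋₊ < N) :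
    effN N * stepsize γ N t / 4 ≤ ∑ r ∈ Finset.Ico (t + 1) N, stepsize γ N r := by
  calc effN N * stepsize γ N t / 4 ≤ ⌊effN N⌋₊ * (stepsize γ N t / 2) := by
        nlinarith [half_effN_le_floor hN, stepsize_nonneg (N := N) hγ t]
    _ = (Finset.Ico (t + 1) (t + 1 + ⌊effN N⌋₊)).card • (stepsize γ N t / 2) := by simp
    _ ≤ ∑ r ∈ Finset.Ico (t + 1) (t + 1 + ⌊effN N⌋₊), stepsize γ N r :=
        Finset.card_nsmul_le_sum _ _ _ fun r hr =>
          half_stepsize_le hγ (by rw [Finset.mem_Ico] at hr; omega)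
    _ ≤ ∑ r ∈ Finset.Ico (t + 1) N, stepsize γ N r :=
        Finset.sum_le_sum_of_subset_of_nonneg (Finset.Ico_subset_Ico le_rfl (by omega))
          fun r _ _ => stepsize_nonneg hγ r

lemma exists_effN_mul_stepsize_mul_mem_Icc (hN : 1 < N) (hγ : 0 ≤ γ) (hl : 0 ≤ l)
    (hγl : γ * l ≤ 1 / 4) (hlarge : 1 ≤ effN N * (γ * l)) :
    ∃ t, t + ⌊effN N⌋₊ ≤ N ∧ effN N * (stepsize γ N t * l) ∈ Set.Icc (1 / 2) 1 := by
  classical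
  have hlate {t : ℕ} (ht : N ≤ t + ⌊effN N⌋₊) : effN N * (stepsize γ N t * l) ≤ 1 :=
    (effN_mul_stepsize_mul_le_of_late hN hγ hl ht).trans (by linarith)
  have hex : ∃ t, effN N * (stepsize γ N t * l) ≤ 1 := ⟨N, hlate (Nat.le_add_right _ _)⟩
  obtain ⟨t, hle, hmin⟩ : ∃ t, effN N * (stepsize γ N t * l) ≤ 1 ∧
      ∀ r < t, 1 < effN N * (stepsize γ N r * l) :=
    ⟨Nat.find hex, Nat.find_spec hex, fun r hr => not_le.1 (Nat.find_min hex hr)⟩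
  refine ⟨t, ?_⟩
  rcases t with _ | t
  · rw [stepsize_zero] at hle ⊢
    exact ⟨by simpa using floor_effN_le_self hN, by linarith, hle⟩
  · have hprev := hmin t t.lt_succ_self
    have hearly : t + ⌊effN N⌋₊ < N := by
      by_contra! h
      exact (hlate h).not_gt hprev
    have hhalf := half_stepsize_le (N := N) hγ
      (Nat.add_le_add_left (Nat.succ_le_of_lt (floor_effN_pos hN)) t)
    have hscaled := mul_le_mul_of_nonneg_left (mul_le_mul_of_nonneg_right hhalf hl)
      (effN_nonneg (N := N))
    exact ⟨by omega, by linarith, hle⟩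

end Stepsize

section Decay

/-- The factor by which the steps `t, …, N - 1` contract an eigendirection of eigenvalue `l`. -/
noncomputable def decay (γ : ℝ) (N : ℕ) (l : ℝ) (t : ℕ) : ℝ :=
  ∏ r ∈ Finset.Ico t N, (1 - stepsize γ N r * l)

/-- The coefficient `γ_t l ∏_{r > t} (1 - γ_r l)` whose square multiplies the noise of step `t` in
the final excess risk along an eigendirection of eigenvalue `l`. -/
noncomputable def noiseGain (γ : ℝ) (N : ℕ) (l : ℝ) (t : ℕ) : ℝ :=
  stepsize γ N t * l * decay γ N l (t + 1)

variable {N : ℕ} {γ l : ℝ}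

lemma decay_nonneg (hγ : 0 ≤ γ) (hl : 0 ≤ l) (hγl : γ * l ≤ 1) (t : ℕ) : 0 ≤ decay γ N l t :=
  Finset.prod_nonneg fun r _ => by linarith [stepsize_mul_le (N := N) hγ hl r]

lemma decay_self : decay γ N l N = 1 := by simp [decay]

lemma decay_eq_prod_mul {t r : ℕ} (htr : t ≤ r) (hr : r ≤ N) :
    decay γ N l t = (∏ k ∈ Finset.Ico t r, (1 - stepsize γ N k * l)) * decay γ N l r :=
  (Finset.prod_Ico_consecutive _ htr hr).symm

lemma decay_le_decay (hγ : 0 ≤ γ) (hl : 0 ≤ l) (hγl : γ * l ≤ 1) {t r : ℕ} (htr : t ≤ r)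
    (hr : r ≤ N) : decay γ N l t ≤ decay γ N l r := by
  rw [decay_eq_prod_mul htr hr]
  exact mul_le_of_le_one_left (decay_nonneg hγ hl hγl r) (Finset.prod_le_one
    (fun k _ => by linarith [stepsize_mul_le (N := N) hγ hl k])
    fun k _ => by linarith [stepsize_mul_nonneg (N := N) hγ hl k])

lemma decay_le_one (hγ : 0 ≤ γ) (hl : 0 ≤ l) (hγl : γ * l ≤ 1) {t : ℕ} (ht : t ≤ N) :
    decay γ N l t ≤ 1 :=
  (decay_le_decay hγ hl hγl ht le_rfl).trans_eq decay_self

lemma decay_succ_sub {t : ℕ} (ht : t < N) :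
    decay γ N l (t + 1) - decay γ N l t = noiseGain γ N l t := by
  rw [noiseGain, decay_eq_prod_mul t.le_succ ht, Nat.Ico_succ_singleton, Finset.prod_singleton]
  ring

lemma decay_mul_one_add_le_one (hγ : 0 ≤ γ) (hl : 0 ≤ l) (hγl : γ * l ≤ 1) (t : ℕ) :
    decay γ N l t * (1 + (∑ r ∈ Finset.Ico t N, stepsize γ N r) * l) ≤ 1 := by
  rw [Finset.sum_mul]
  exact prod_one_sub_mul_one_add_sum_le_one _ (fun r _ => stepsize_mul_nonneg hγ hl r)
    fun r _ => (stepsize_mul_le hγ hl r).trans hγl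

lemma exp_le_decay (hN : 1 < N) (hγ : 0 ≤ γ) (hl : 0 ≤ l) (hγl : γ * l ≤ 1 / 2) {t : ℕ}
    (ht : effN N * (stepsize γ N t * l) ≤ 1) : Real.exp (-8) ≤ decay γ N l t := by
  refine le_trans (Real.exp_le_exp.2 ?_) (exp_neg_two_mul_sum_le_prod_one_sub _
    (fun r _ => stepsize_mul_nonneg hγ hl r) fun r _ => (stepsize_mul_le hγ hl r).trans hγl)
  rw [← Finset.sum_mul]
  linarith [mul_le_mul_of_nonneg_right (sum_stepsize_Ico_le hN hγ t) hl]

lemma noiseGain_nonneg (hγ : 0 ≤ γ) (hl : 0 ≤ l) (hγl : γ * l ≤ 1) (t : ℕ) :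
    0 ≤ noiseGain γ N l t :=
  mul_nonneg (stepsize_mul_nonneg hγ hl t) (decay_nonneg hγ hl hγl _)

lemma noiseGain_le_stepsize_mul (hγ : 0 ≤ γ) (hl : 0 ≤ l) (hγl : γ * l ≤ 1) {t : ℕ}
    (ht : t < N) : noiseGain γ N l t ≤ stepsize γ N t * l :=
  mul_le_of_le_one_right (stepsize_mul_nonneg hγ hl t) (decay_le_one hγ hl hγl ht)

lemma noiseGain_le (hγ : 0 ≤ γ) (hl : 0 ≤ l) (hγl : γ * l ≤ 1) {t : ℕ} (ht : t < N) :
    noiseGain γ N l t ≤ γ * l :=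
  (noiseGain_le_stepsize_mul hγ hl hγl ht).trans (stepsize_mul_le hγ hl t)

lemma noiseGain_le_div_effN (hN : 1 < N) (hγ : 0 ≤ γ) (hl : 0 ≤ l) (hγl : γ * l ≤ 1) {t : ℕ}
    (ht : t < N) : noiseGain γ N l t ≤ 4 / effN N := by
  rw [le_div_iff₀ (effN_pos hN)]
  rcases lt_or_ge (t + ⌊effN N⌋₊) N with hearly | hlate
  · have htail := mul_le_mul_of_nonneg_right (le_sum_stepsize_Ico hN hγ hearly) hl
    have hdecay := decay_nonneg (N := N) hγ hl hγl (t + 1)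
    have hone := decay_mul_one_add_le_one (N := N) hγ hl hγl (t + 1)
    rw [noiseGain]
    nlinarith [mul_le_mul_of_nonneg_left htail hdecay]
  · calc noiseGain γ N l t * effN N ≤ stepsize γ N t * l * effN N :=
          mul_le_mul_of_nonneg_right (noiseGain_le_stepsize_mul hγ hl hγl ht) effN_nonneg
      _ ≤ 4 * (γ * l) := by
          rw [mul_comm]
          exact effN_mul_stepsize_mul_le_of_late hN hγ hl hlate
      _ ≤ 4 := by linarith

lemma sum_noiseGain_sq_le_div_effN (hN : 1 < N) (hγ : 0 ≤ γ) (hl : 0 ≤ l) (hγl : γ * l ≤ 1) :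
    ∑ t ∈ Finset.range N, noiseGain γ N l t ^ 2 ≤ 4 / effN N := by
  have hn := effN_pos hN
  calc ∑ t ∈ Finset.range N, noiseGain γ N l t ^ 2
      ≤ ∑ t ∈ Finset.range N, 4 / effN N * noiseGain γ N l t :=
        Finset.sum_le_sum fun t ht => by
          rw [sq]
          exact mul_le_mul_of_nonneg_right
            (noiseGain_le_div_effN hN hγ hl hγl (Finset.mem_range.1 ht))
            (noiseGain_nonneg hγ hl hγl t)
    _ = 4 / effN N * (decay γ N l N - decay γ N l 0) := by
        rw [← Finset.mul_sum, ← Finset.sum_range_sub]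
        congr 1
        exact Finset.sum_congr rfl fun t ht => (decay_succ_sub (Finset.mem_range.1 ht)).symm
    _ ≤ 4 / effN N := by
        rw [decay_self]
        exact mul_le_of_le_one_right (by positivity)
          (by linarith [decay_nonneg (N := N) hγ hl hγl 0])

lemma sum_noiseGain_sq_le (hN : 1 < N) (hγ : 0 ≤ γ) (hl : 0 ≤ l) (hγl : γ * l ≤ 1) :
    ∑ t ∈ Finset.range N, noiseGain γ N l t ^ 2 ≤ 4 * effN N * (γ * l) ^ 2 := by
  have hsum := sum_stepsize_Ico_le hN hγ 0
  rw [stepsize_zero] at hsum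
  calc ∑ t ∈ Finset.range N, noiseGain γ N l t ^ 2
      ≤ ∑ t ∈ Finset.range N, stepsize γ N t * l * (γ * l) :=
        Finset.sum_le_sum fun t ht => by
          have ht := Finset.mem_range.1 ht
          rw [sq]
          exact mul_le_mul (noiseGain_le_stepsize_mul hγ hl hγl ht) (noiseGain_le hγ hl hγl ht)
            (noiseGain_nonneg hγ hl hγl t) (stepsize_mul_nonneg hγ hl t)
    _ = (∑ t ∈ Finset.Ico 0 N, stepsize γ N t) * l * (γ * l) := by
        rw [← Finset.sum_mul, ← Finset.sum_mul, Finset.range_eq_Ico]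
    _ ≤ 4 * effN N * γ * l * (γ * l) := by gcongr
    _ = 4 * effN N * (γ * l) ^ 2 := by ring

lemma le_sum_noiseGain_sq (hN : 1 < N) (hγ : 0 ≤ γ) (hl : 0 ≤ l) (hγl : γ * l ≤ 1 / 2) {t : ℕ}
    (ht : t + ⌊effN N⌋₊ ≤ N) (hx : effN N * (stepsize γ N t * l) ≤ 1) :
    Real.exp (-16) / 8 * effN N * (stepsize γ N t * l) ^ 2 ≤
      ∑ r ∈ Finset.range N, noiseGain γ N l r ^ 2 := by
  have hx0 := stepsize_mul_nonneg (N := N) hγ hl t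
  have hexp : Real.exp (-16) = Real.exp (-8) ^ 2 := by rw [← Real.exp_nat_mul]; norm_num
  have hgain : ∀ r ∈ Finset.Ico t (t + ⌊effN N⌋₊),
      (stepsize γ N t * l / 2 * Real.exp (-8)) ^ 2 ≤ noiseGain γ N l r ^ 2 := by
    intro r hr
    rw [Finset.mem_Ico] at hr
    have hstep := mul_le_mul_of_nonneg_right (half_stepsize_le (N := N) hγ hr.2.le) hl
    have hdecay := (exp_le_decay hN hγ hl hγl hx).trans
      (decay_le_decay hγ hl (by linarith) (hr.1.trans r.le_succ) (by omega))
    refine pow_le_pow_left₀ (by positivity) (mul_le_mul (by linarith) hdecay (by positivity)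
      (stepsize_mul_nonneg hγ hl r)) 2
  calc Real.exp (-16) / 8 * effN N * (stepsize γ N t * l) ^ 2
      = effN N / 2 * (stepsize γ N t * l / 2 * Real.exp (-8)) ^ 2 := by rw [hexp]; ring
    _ ≤ ⌊effN N⌋₊ * (stepsize γ N t * l / 2 * Real.exp (-8)) ^ 2 :=
        mul_le_mul_of_nonneg_right (half_effN_le_floor hN) (sq_nonneg _)
    _ = (Finset.Ico t (t + ⌊effN N⌋₊)).card • (stepsize γ N t * l / 2 * Real.exp (-8)) ^ 2 := by
        simp
    _ ≤ ∑ r ∈ Finset.Ico t (t + ⌊effN N⌋₊), noiseGain γ N l r ^ 2 :=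
        Finset.card_nsmul_le_sum _ _ _ hgain
    _ ≤ ∑ r ∈ Finset.range N, noiseGain γ N l r ^ 2 := by
        rw [Finset.range_eq_Ico]
        exact Finset.sum_le_sum_of_subset_of_nonneg (Finset.Ico_subset_Ico t.zero_le ht)
          fun r _ _ => sq_nonneg _

lemma le_sum_noiseGain_sq_of_small (hN : 1 < N) (hγ : 0 ≤ γ) (hl : 0 ≤ l) (hγl : γ * l ≤ 1 / 2)
    (hx : effN N * (γ * l) ≤ 1) :
    Real.exp (-16) / 8 * effN N * (γ * l) ^ 2 ≤ ∑ r ∈ Finset.range N, noiseGain γ N l r ^ 2 := by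
  simpa only [stepsize_zero] using le_sum_noiseGain_sq hN hγ hl hγl (t := 0)
    (by simpa using floor_effN_le_self hN) (by rwa [stepsize_zero])

lemma le_sum_noiseGain_sq_of_large (hN : 1 < N) (hγ : 0 ≤ γ) (hl : 0 ≤ l) (hγl : γ * l ≤ 1 / 4)
    (hx : 1 ≤ effN N * (γ * l)) :
    Real.exp (-16) / 32 / effN N ≤ ∑ r ∈ Finset.range N, noiseGain γ N l r ^ 2 := by
  have hn := effN_pos hN
  obtain ⟨t, ht, hlower, hupper⟩ := exists_effN_mul_stepsize_mul_mem_Icc hN hγ hl hγl hx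
  calc Real.exp (-16) / 32 / effN N
      = Real.exp (-16) / 8 / effN N * (1 / 2) ^ 2 := by ring
    _ ≤ Real.exp (-16) / 8 / effN N * (effN N * (stepsize γ N t * l)) ^ 2 := by gcongr
    _ = Real.exp (-16) / 8 * effN N * (stepsize γ N t * l) ^ 2 := by field_simp
    _ ≤ ∑ r ∈ Finset.range N, noiseGain γ N l r ^ 2 :=
        le_sum_noiseGain_sq hN hγ hl (by linarith) ht hupper

end Decay

section Weights

variable {ι : Type*} {lam : ι → ℝ} {K : Set ι} {i : ι} {N : ℕ} {γ a : ℝ}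

open Classical in
/-- The contribution of each eigendirection to the effective dimension. -/
noncomputable def effDimWeights (lam : ι → ℝ) (γ : ℝ) (N : ℕ) (K : Set ι) : ι → ℝ :=
  fun i => if i ∈ K then 1 else (effN N * (γ * lam i)) ^ 2

lemma effDimWeights_of_mem (hi : i ∈ K) : effDimWeights lam γ N K i = 1 := if_pos hi

lemma effDimWeights_of_notMem (hi : i ∉ K) :
    effDimWeights lam γ N K i = (effN N * (γ * lam i)) ^ 2 := if_neg hi

lemma effDimWeights_nonneg (i : ι) : 0 ≤ effDimWeights lam γ N K i := by
  unfold effDimWeights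
  split_ifs <;> positivity

lemma splitWeights_of_mem (hi : i ∈ K) : splitWeights lam K a i = a := if_pos hi

lemma splitWeights_of_notMem (hi : i ∉ K) : splitWeights lam K a i = lam i := if_neg hi

lemma splitWeights_nonneg (hl : ∀ i, 0 ≤ lam i) (ha : 0 ≤ a) (i : ι) :
    0 ≤ splitWeights lam K a i := by
  unfold splitWeights
  split_ifs
  exacts [ha, hl i]

lemma noiseGain_sq_le_effDimWeights (hN : 1 < N) (hγ : 0 ≤ γ) (hl : 0 ≤ lam i)
    (hγl : γ * lam i ≤ 1) {t : ℕ} (ht : t < N) :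
    noiseGain γ N (lam i) t ^ 2 ≤ 16 * effDimWeights lam γ N K i / effN N ^ 2 := by
  have hn := effN_pos hN
  have hgain := noiseGain_nonneg (N := N) hγ hl hγl t
  by_cases hi : i ∈ K
  · rw [effDimWeights_of_mem hi]
    exact (pow_le_pow_left₀ hgain (noiseGain_le_div_effN hN hγ hl hγl ht) 2).trans_eq
      (by rw [div_pow]; norm_num)
  · rw [effDimWeights_of_notMem hi, mul_pow, mul_left_comm, mul_div_cancel_left₀ _ (by positivity)]
    have hsq := pow_le_pow_left₀ hgain (noiseGain_le hγ hl hγl ht) 2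
    linarith [sq_nonneg (γ * lam i)]

lemma sum_noiseGain_sq_le_effDimWeights (hN : 1 < N) (hγ : 0 ≤ γ) (hl : 0 ≤ lam i)
    (hγl : γ * lam i ≤ 1) :
    ∑ t ∈ Finset.range N, noiseGain γ N (lam i) t ^ 2 ≤
      4 * (effDimWeights lam γ N K i / effN N) := by
  have hn := effN_pos hN
  by_cases hi : i ∈ K
  · rw [effDimWeights_of_mem hi, mul_one_div]
    exact sum_noiseGain_sq_le_div_effN hN hγ hl hγl
  · rw [effDimWeights_of_notMem hi]
    exact (sum_noiseGain_sq_le hN hγ hl hγl).trans_eq (by field_simp)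

lemma mem_optSet_iff (hN : 1 < N) (hγ : 0 < γ) :
    i ∈ optSet lam γ N ↔ 1 ≤ effN N * (γ * lam i) := by
  have hn := effN_pos hN
  rw [optSet, Set.mem_ofPred_eq, div_le_iff₀ (by positivity)]
  ring_nf

lemma effDimWeights_optSet_le_sum_noiseGain_sq (hN : 1 < N) (hγ : 0 < γ) (hl : 0 ≤ lam i)
    (hγl : γ * lam i ≤ 1 / 4) :
    Real.exp (-16) / 32 * (effDimWeights lam γ N (optSet lam γ N) i / effN N) ≤
      ∑ t ∈ Finset.range N, noiseGain γ N (lam i) t ^ 2 := by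
  have hn := effN_pos hN
  by_cases hi : i ∈ optSet lam γ N
  · rw [effDimWeights_of_mem hi, mul_one_div]
    exact le_sum_noiseGain_sq_of_large hN hγ.le hl hγl ((mem_optSet_iff hN hγ).1 hi)
  · rw [effDimWeights_of_notMem hi]
    calc Real.exp (-16) / 32 * ((effN N * (γ * lam i)) ^ 2 / effN N)
        = Real.exp (-16) / 8 * effN N * (γ * lam i) ^ 2 / 4 := by field_simp; ring
      _ ≤ Real.exp (-16) / 8 * effN N * (γ * lam i) ^ 2 := div_le_self (by positivity) (by norm_num)
      _ ≤ ∑ t ∈ Finset.range N, noiseGain γ N (lam i) t ^ 2 :=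
          le_sum_noiseGain_sq_of_small hN hγ.le hl (by linarith)
            (not_le.1 fun h => hi ((mem_optSet_iff hN hγ).2 h)).le

end Weights

section UpperRecursion

variable {ι : Type*} {lam : ι → ℝ} {s : ℕ → ι → ℝ} {K : Set ι} {N : ℕ} {γ α V : ℝ}

/-- The energy `∑ λᵢ sᵢ`: twice the excess risk, when `sᵢ` is the squared error along the `i`-th
eigendirection. -/
noncomputable def energy (lam s : ι → ℝ) : ℝ := ∑' i, lam i * s i

/-- The constraints on the eigenvalues and the initial stepsize under which SGD is stable. -/
structure AdmissibleStepsize (lam : ι → ℝ) (γ α : ℝ) : Prop where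
  eigenvalue_nonneg : ∀ i, 0 ≤ lam i
  summable : Summable lam
  pos : 0 < γ
  one_le : 1 ≤ α
  mul_tsum_le : γ * α * ∑' i, lam i ≤ 1 / 4

/-- The recursive inequality satisfied by the mean squared errors `s t i` of `N` steps of SGD along
the eigendirections: the noise injected by a step is proportional to the current energy, up to the
variance `V` of the label noise. -/
structure UpperRecursion (lam : ι → ℝ) (γ : ℝ) (N : ℕ) (α V : ℝ) (s : ℕ → ι → ℝ) : Prop where
  noise_nonneg : 0 ≤ V
  nonneg : ∀ t i, 0 ≤ s t i
  summable : ∀ t ≤ N, Summable (s t)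
  succ_le : ∀ t < N, ∀ i, s (t + 1) i ≤ (1 - stepsize γ N t * lam i) ^ 2 * s t i +
    2 * stepsize γ N t ^ 2 * lam i * (α * energy lam (s t) + V)

namespace AdmissibleStepsize

lemma mul_eigenvalue_le (h : AdmissibleStepsize lam γ α) (i : ι) : γ * lam i ≤ 1 / 4 := by
  have htrace : 0 ≤ ∑' i, lam i := tsum_nonneg h.eigenvalue_nonneg
  calc γ * lam i ≤ γ * ∑' i, lam i := mul_le_mul_of_nonneg_left
        (h.summable.le_tsum i fun j _ => h.eigenvalue_nonneg j) h.pos.le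
    _ ≤ γ * α * ∑' i, lam i := mul_le_mul_of_nonneg_right
        (le_mul_of_one_le_right h.pos.le h.one_le) htrace
    _ ≤ 1 / 4 := h.mul_tsum_le

lemma mul_eigenvalue_le_one (h : AdmissibleStepsize lam γ α) (i : ι) : γ * lam i ≤ 1 :=
  (h.mul_eigenvalue_le i).trans (by norm_num)

lemma coeff_nonneg (h : AdmissibleStepsize lam γ α) : 0 ≤ α := zero_le_one.trans h.one_le

end AdmissibleStepsize

lemma energy_nonneg (hl : ∀ i, 0 ≤ lam i) {u : ι → ℝ} (hu : ∀ i, 0 ≤ u i) : 0 ≤ energy lam u :=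
  tsum_nonneg fun i => mul_nonneg (hl i) (hu i)

lemma summable_mul_of_summable_of_nonneg {f g : ι → ℝ} (hf0 : ∀ i, 0 ≤ f i) (hg0 : ∀ i, 0 ≤ g i)
    (hf : Summable f) (hg : Summable g) : Summable fun i => f i * g i :=
  (hg.mul_left (∑' i, f i)).of_nonneg_of_le (fun i => mul_nonneg (hf0 i) (hg0 i))
    fun i => mul_le_mul_of_nonneg_right (hf.le_tsum i fun j _ => hf0 j) (hg0 i)

namespace UpperRecursion

lemma energy_nonneg (h : AdmissibleStepsize lam γ α) (hs : UpperRecursion lam γ N α V s) (t : ℕ) :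
    0 ≤ energy lam (s t) :=
  TargetSGD.energy_nonneg h.eigenvalue_nonneg (hs.nonneg t)

lemma noise_total_nonneg (h : AdmissibleStepsize lam γ α) (hs : UpperRecursion lam γ N α V s)
    (t : ℕ) : 0 ≤ α * energy lam (s t) + V :=
  add_nonneg (mul_nonneg h.coeff_nonneg (hs.energy_nonneg h t)) hs.noise_nonneg

lemma summable_energy (h : AdmissibleStepsize lam γ α) (hs : UpperRecursion lam γ N α V s) {t : ℕ}
    (ht : t ≤ N) : Summable fun i => lam i * s t i :=
  summable_mul_of_summable_of_nonneg h.eigenvalue_nonneg (hs.nonneg t) h.summable (hs.summable t ht)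

lemma succ_le_one_sub (h : AdmissibleStepsize lam γ α) (hs : UpperRecursion lam γ N α V s) {t : ℕ}
    (ht : t < N) (i : ι) :
    s (t + 1) i ≤ (1 - stepsize γ N t * lam i) * s t i +
      2 * stepsize γ N t ^ 2 * lam i * (α * energy lam (s t) + V) := by
  have hx0 := stepsize_mul_nonneg (N := N) h.pos.le (h.eigenvalue_nonneg i) t
  have hx1 := (stepsize_mul_le (N := N) h.pos.le (h.eigenvalue_nonneg i) t).trans
    (h.mul_eigenvalue_le_one i)
  refine (hs.succ_le t ht i).trans (add_le_add_left (mul_le_mul_of_nonneg_right ?_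
    (hs.nonneg t i)) _)
  exact pow_le_of_le_one (sub_nonneg.2 hx1) (by linarith) two_ne_zero

lemma sum_first_phase_coord_le (hN : 1 < N) (h : AdmissibleStepsize lam γ α)
    (hs : UpperRecursion lam γ N α V s) (K : Set ι) (i : ι) :
    γ * lam i * ∑ t ∈ Finset.range ⌊effN N⌋₊, s t i ≤
      effN N * γ * (splitWeights lam K (1 / (effN N * γ)) i * s 0 i) +
        lam i * ∑ t ∈ Finset.range ⌊effN N⌋₊, 2 * γ ^ 2 * (α * energy lam (s t) + V) := by
  have hn := effN_pos hN
  have hγ := h.pos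
  have hx0 : 0 ≤ γ * lam i := mul_nonneg hγ.le (h.eigenvalue_nonneg i)
  have hrec : ∀ t < ⌊effN N⌋₊, s (t + 1) i ≤ (1 - γ * lam i) * s t i +
      lam i * (2 * γ ^ 2 * (α * energy lam (s t) + V)) := fun t ht => by
    have hstep := hs.succ_le_one_sub h (ht.trans_le (floor_effN_le_self hN)) i
    rw [stepsize_eq_of_lt_floor ht] at hstep
    linarith
  rw [Finset.mul_sum _ _ (lam i)]
  by_cases hi : i ∈ K
  · rw [splitWeights_of_mem hi, ← mul_assoc, mul_one_div_cancel (by positivity), one_mul]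
    exact mul_sum_le_of_contraction (s := fun t => s t i) (hs.nonneg _ i) hrec
  · rw [splitWeights_of_notMem hi]
    refine (mul_sum_le_mul_init_of_contraction (s := fun t => s t i)
      (f := fun t => lam i * (2 * γ ^ 2 * (α * energy lam (s t) + V))) hx0
      (h.mul_eigenvalue_le_one i) (hs.nonneg 0 i)
      (fun t => mul_nonneg (h.eigenvalue_nonneg i)
        (mul_nonneg (by positivity) (hs.noise_total_nonneg h t))) hrec).trans ?_
    linarith [mul_le_mul_of_nonneg_right (floor_effN_le (N := N))
      (mul_nonneg hx0 (hs.nonneg 0 i))]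

lemma sum_first_phase_energy_le (hN : 1 < N) (h : AdmissibleStepsize lam γ α)
    (hs : UpperRecursion lam γ N α V s)
    (hK : Summable fun i => splitWeights lam K (1 / (effN N * γ)) i * s 0 i) :
    γ * ∑ t ∈ Finset.range ⌊effN N⌋₊, energy lam (s t) ≤
      effN N * γ * energy (splitWeights lam K (1 / (effN N * γ))) (s 0) +
        (∑' i, lam i) * ∑ t ∈ Finset.range ⌊effN N⌋₊, 2 * γ ^ 2 * (α * energy lam (s t) + V) := by
  have hsum : ∀ t ∈ Finset.range ⌊effN N⌋₊, Summable fun i => γ * (lam i * s t i) := fun t ht =>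
    (hs.summable_energy h ((Finset.mem_range.1 ht).le.trans (floor_effN_le_self hN))).mul_left γ
  set F := ∑ t ∈ Finset.range ⌊effN N⌋₊, 2 * γ ^ 2 * (α * energy lam (s t) + V)
  calc γ * ∑ t ∈ Finset.range ⌊effN N⌋₊, energy lam (s t)
      = ∑' i, ∑ t ∈ Finset.range ⌊effN N⌋₊, γ * (lam i * s t i) := by
        rw [Summable.tsum_finsetSum hsum, Finset.mul_sum]
        simp only [energy, tsum_mul_left]
    _ ≤ ∑' i, (effN N * γ * (splitWeights lam K (1 / (effN N * γ)) i * s 0 i) + lam i * F) := by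
        refine (summable_sum hsum).tsum_le_tsum (fun i => ?_)
          ((hK.mul_left _).add (h.summable.mul_right _))
        rw [← Finset.mul_sum, ← Finset.mul_sum, ← mul_assoc]
        exact hs.sum_first_phase_coord_le hN h K i
    _ = _ := by
        rw [(hK.mul_left _).tsum_add (h.summable.mul_right _), tsum_mul_left, tsum_mul_right,
          energy]

/- Self-bounding: by the stepsize condition, at most half of the energy collected in the first
phase is regenerated by the noise that it causes. -/
lemma mul_sum_first_phase_energy_le (hN : 1 < N) (h : AdmissibleStepsize lam γ α)
    (hs : UpperRecursion lam γ N α V s)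
    (hK : Summable fun i => splitWeights lam K (1 / (effN N * γ)) i * s 0 i) :
    α * ∑ t ∈ Finset.range ⌊effN N⌋₊, energy lam (s t) ≤
      effN N * (2 * (α * energy (splitWeights lam K (1 / (effN N * γ))) (s 0)) + V) := by
  have hα := h.coeff_nonneg
  have hγ := h.pos
  have htotal := mul_le_mul_of_nonneg_left (hs.sum_first_phase_energy_le hN h hK) hα
  set X := ∑ t ∈ Finset.range ⌊effN N⌋₊, energy lam (s t)
  set M := energy (splitWeights lam K (1 / (effN N * γ))) (s 0)
  have hnoise : ∑ t ∈ Finset.range ⌊effN N⌋₊, 2 * γ ^ 2 * (α * energy lam (s t) + V) =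
      2 * γ ^ 2 * (α * X + ⌊effN N⌋₊ * V) := by
    simp only [← Finset.mul_sum, Finset.sum_add_distrib, Finset.sum_const, Finset.card_range,
      nsmul_eq_mul, X]
  have hX : 0 ≤ X := Finset.sum_nonneg fun t _ => hs.energy_nonneg h t
  have hV := hs.noise_nonneg
  have hregen : α * ((∑' i, lam i) * (2 * γ ^ 2 * (α * X + ⌊effN N⌋₊ * V))) ≤
      γ / 2 * (α * X + ⌊effN N⌋₊ * V) := by
    have := mul_le_mul_of_nonneg_right h.mul_tsum_le
      (by positivity : 0 ≤ 2 * γ * (α * X + ⌊effN N⌋₊ * V))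
    linarith
  rw [hnoise] at htotal
  have hself : γ * (α * X) ≤ γ * (effN N * (α * M) + (α * X + ⌊effN N⌋₊ * V) / 2) := by linarith
  linarith [le_of_mul_le_mul_left hself hγ, mul_le_mul_of_nonneg_right (floor_effN_le (N := N)) hV]

lemma exists_energy_le (hN : 1 < N) (h : AdmissibleStepsize lam γ α)
    (hs : UpperRecursion lam γ N α V s)
    (hK : Summable fun i => splitWeights lam K (1 / (effN N * γ)) i * s 0 i) :
    ∃ t < ⌊effN N⌋₊, α * energy lam (s t) ≤
      2 * (2 * (α * energy (splitWeights lam K (1 / (effN N * γ))) (s 0)) + V) := by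
  have hn := effN_pos hN
  have : (0 : ℝ) < ⌊effN N⌋₊ := by exact_mod_cast floor_effN_pos hN
  have hsum := hs.mul_sum_first_phase_energy_le hN h hK
  set B := 2 * (α * energy (splitWeights lam K (1 / (effN N * γ))) (s 0)) + V
  have hB : 0 ≤ effN N * B := (mul_nonneg h.coeff_nonneg
    (Finset.sum_nonneg fun t _ => hs.energy_nonneg h t)).trans hsum
  obtain ⟨t, ht, hle⟩ : ∃ t ∈ Finset.range ⌊effN N⌋₊, α * energy lam (s t) ≤ 2 * B := by
    refine Finset.exists_le_of_sum_le (Finset.nonempty_range_iff.2 (floor_effN_pos hN).ne') ?_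
    rw [← Finset.mul_sum, Finset.sum_const, Finset.card_range, nsmul_eq_mul]
    have := mul_le_mul_of_nonneg_right (half_effN_le_floor hN) (nonneg_of_mul_nonneg_right hB hn)
    linarith
  exact ⟨t, Finset.mem_range.1 ht, hle⟩

lemma energy_le_of_forall_le (h : AdmissibleStepsize lam γ α) (hs : UpperRecursion lam γ N α V s)
    {t r : ℕ} (ht : t ≤ N) (hr : r ≤ N) {b : ℝ} (hle : ∀ i, s r i ≤ s t i + b) :
    energy lam (s r) ≤ energy lam (s t) + (∑' i, lam i) * b := by
  have hsm := hs.summable_energy h ht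
  rw [energy, energy, ← tsum_mul_right, ← hsm.tsum_add (h.summable.mul_right _)]
  refine (hs.summable_energy h hr).tsum_le_tsum (fun i => ?_) (hsm.add (h.summable.mul_right _))
  rw [← mul_add]
  exact mul_le_mul_of_nonneg_left (hle i) (h.eigenvalue_nonneg i)

/- Propagated together: as long as every coordinate has grown by at most `2 γ (B + V)`, where `B` is
the asserted bound, the energy stays below `B`, and then the next step preserves the coordinate
bounds. -/
lemma energy_persists (h : AdmissibleStepsize lam γ α) (hs : UpperRecursion lam γ N α V s)
    {t r : ℕ} (htr : t ≤ r) (hr : r ≤ N) :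
    α * energy lam (s r) ≤ 2 * (α * energy lam (s t)) + V := by
  have hV := hs.noise_nonneg
  have hγ := h.pos.le
  set B := 2 * (α * energy lam (s t)) + V
  have hBV : 0 ≤ B + V := by
    have := mul_nonneg h.coeff_nonneg (hs.energy_nonneg h t)
    positivity
  have henergy {r : ℕ} (hr : r ≤ N) (htN : t ≤ N) (hle : ∀ i, s r i ≤ s t i + 2 * γ * (B + V)) :
      α * energy lam (s r) ≤ B := by
    have hgrow := mul_le_mul_of_nonneg_left (hs.energy_le_of_forall_le h htN hr hle) h.coeff_nonneg
    linarith [mul_le_mul_of_nonneg_right h.mul_tsum_le (by positivity : 0 ≤ 2 * (B + V))]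
  refine henergy hr (htr.trans hr) ?_
  induction r, htr using Nat.le_induction with
  | base => exact fun i => le_add_of_nonneg_right (by positivity)
  | succ r htr ih =>
    intro i
    have hrN : r < N := hr
    have hcoord := ih hrN.le
    have hx0 := stepsize_mul_nonneg (N := N) hγ (h.eigenvalue_nonneg i) r
    have hx1 := (stepsize_mul_le (N := N) hγ (h.eigenvalue_nonneg i) r).trans
      (h.mul_eigenvalue_le_one i)
    have hnoise : α * energy lam (s r) + V ≤ B + V :=
      add_le_add_left (henergy hrN.le (htr.trans hrN.le) hcoord) V
    set g := stepsize γ N r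
    have hg : g ≤ γ := stepsize_le hγ r
    calc s (r + 1) i
        ≤ (1 - g * lam i) * s r i + 2 * g * (g * lam i) * (α * energy lam (s r) + V) :=
          (hs.succ_le_one_sub h hrN i).trans_eq (by ring)
      _ ≤ (1 - g * lam i) * (s t i + 2 * γ * (B + V)) + 2 * γ * (g * lam i) * (B + V) := by
          have := stepsize_nonneg (N := N) hγ r
          have := hs.noise_total_nonneg h r
          gcongr
          exact hcoord i
      _ ≤ s t i + 2 * γ * (B + V) := by linarith [mul_nonneg hx0 (hs.nonneg t i)]

lemma le_unrolled (h : AdmissibleStepsize lam γ α) (hs : UpperRecursion lam γ N α V s) (i : ι) :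
    lam i * s N i ≤ lam i * decay γ N (lam i) 0 ^ 2 * s 0 i +
      ∑ t ∈ Finset.range N, noiseGain γ N (lam i) t ^ 2 * (2 * (α * energy lam (s t) + V)) := by
  refine (mul_le_mul_of_nonneg_left (le_unroll (s := fun t => s t i) (fun t => sq_nonneg _)
    fun t ht => hs.succ_le t ht i) (h.eigenvalue_nonneg i)).trans_eq ?_
  rw [mul_add, Finset.mul_sum, ← mul_assoc, Finset.prod_pow]
  congr 1
  refine Finset.sum_congr rfl fun t _ => ?_
  rw [noiseGain, decay, Finset.prod_pow]
  ring

end UpperRecursion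

lemma sum_mul_le_of_early_of_late {q f : ℕ → ℝ} {m N : ℕ} {Q A : ℝ} (hmN : m ≤ N) (hA : 0 ≤ A)
    (hq0 : ∀ t, 0 ≤ q t) (hf0 : ∀ t, 0 ≤ f t) (hq : ∀ t < N, q t ≤ Q)
    (hf : ∀ t, m ≤ t → t ≤ N → f t ≤ A) :
    ∑ t ∈ Finset.range N, q t * f t ≤
      Q * ∑ t ∈ Finset.range m, f t + (∑ t ∈ Finset.range N, q t) * A := by
  have hlate : ∑ t ∈ Finset.Ico m N, q t * f t ≤ (∑ t ∈ Finset.range N, q t) * A := by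
    calc ∑ t ∈ Finset.Ico m N, q t * f t ≤ ∑ t ∈ Finset.Ico m N, q t * A :=
          Finset.sum_le_sum fun t ht => mul_le_mul_of_nonneg_left
            (hf t (Finset.mem_Ico.1 ht).1 (Finset.mem_Ico.1 ht).2.le) (hq0 t)
      _ ≤ ∑ t ∈ Finset.range N, q t * A := by
          rw [Finset.range_eq_Ico]
          exact Finset.sum_le_sum_of_subset_of_nonneg (Finset.Ico_subset_Ico m.zero_le le_rfl)
            fun t _ _ => mul_nonneg (hq0 t) hA
      _ = _ := (Finset.sum_mul ..).symm
  rw [← Finset.sum_range_add_sum_Ico _ hmN, Finset.mul_sum]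
  refine add_le_add (Finset.sum_le_sum fun t ht => ?_) hlate
  exact mul_le_mul_of_nonneg_right (hq t ((Finset.mem_range.1 ht).trans_le hmN)) (hf0 t)

namespace UpperRecursion

lemma sum_first_phase_noise_le (hN : 1 < N) (h : AdmissibleStepsize lam γ α)
    (hs : UpperRecursion lam γ N α V s)
    (hK : Summable fun i => splitWeights lam K (1 / (effN N * γ)) i * s 0 i) :
    ∑ t ∈ Finset.range ⌊effN N⌋₊, 2 * (α * energy lam (s t) + V) ≤
      4 * effN N * (α * energy (splitWeights lam K (1 / (effN N * γ))) (s 0) + V) := by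
  rw [← Finset.mul_sum, Finset.sum_add_distrib, ← Finset.mul_sum, Finset.sum_const,
    Finset.card_range, nsmul_eq_mul]
  linarith [mul_le_mul_of_nonneg_right (floor_effN_le (N := N)) hs.noise_nonneg,
    hs.mul_sum_first_phase_energy_le hN h hK]

lemma noise_le_of_floor_le (hN : 1 < N) (h : AdmissibleStepsize lam γ α)
    (hs : UpperRecursion lam γ N α V s)
    (hK : Summable fun i => splitWeights lam K (1 / (effN N * γ)) i * s 0 i) {t : ℕ}
    (ht : ⌊effN N⌋₊ ≤ t) (htN : t ≤ N) :
    2 * (α * energy lam (s t) + V) ≤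
      16 * (α * energy (splitWeights lam K (1 / (effN N * γ))) (s 0) + V) := by
  obtain ⟨t₀, ht₀, hsmall⟩ := hs.exists_energy_le hN h hK
  linarith [hs.energy_persists h (ht₀.le.trans ht) htN, hs.noise_nonneg]

lemma coord_le (hN : 1 < N) (h : AdmissibleStepsize lam γ α) (hs : UpperRecursion lam γ N α V s)
    (hK : Summable fun i => splitWeights lam K (1 / (effN N * γ)) i * s 0 i) (i : ι) :
    lam i * s N i ≤ lam i * decay γ N (lam i) 0 ^ 2 * s 0 i +
      128 * (α * energy (splitWeights lam K (1 / (effN N * γ))) (s 0) + V) *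
        (effDimWeights lam γ N K i / effN N) := by
  have hn := effN_pos hN
  have hγ := h.pos
  have hl := h.eigenvalue_nonneg
  have hgain := h.mul_eigenvalue_le_one i
  have hearly := hs.sum_first_phase_noise_le hN h hK
  have hlate := fun t => hs.noise_le_of_floor_le hN h hK (t := t)
  set M := energy (splitWeights lam K (1 / (effN N * γ))) (s 0)
  set d := effDimWeights lam γ N K i
  have hM : 0 ≤ M := TargetSGD.energy_nonneg (splitWeights_nonneg hl (by positivity)) (hs.nonneg 0)
  have hA : 0 ≤ α * M + V := add_nonneg (mul_nonneg h.coeff_nonneg hM) hs.noise_nonneg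
  have hd : 0 ≤ d := effDimWeights_nonneg i
  refine (hs.le_unrolled h i).trans (add_le_add_right ?_ _)
  calc ∑ t ∈ Finset.range N, noiseGain γ N (lam i) t ^ 2 * (2 * (α * energy lam (s t) + V))
      ≤ 16 * d / effN N ^ 2 *
            ∑ t ∈ Finset.range ⌊effN N⌋₊, 2 * (α * energy lam (s t) + V) +
          (∑ t ∈ Finset.range N, noiseGain γ N (lam i) t ^ 2) * (16 * (α * M + V)) :=
        sum_mul_le_of_early_of_late (floor_effN_le_self hN) (by positivity) (fun t => sq_nonneg _)
          (fun t => mul_nonneg zero_le_two (hs.noise_total_nonneg h t))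
          (fun t ht => noiseGain_sq_le_effDimWeights hN hγ.le (hl i) hgain ht) hlate
    _ ≤ 16 * d / effN N ^ 2 * (4 * effN N * (α * M + V)) +
          4 * (d / effN N) * (16 * (α * M + V)) := by
        gcongr
        exact sum_noiseGain_sq_le_effDimWeights hN hγ.le (hl i) hgain
    _ = 128 * (α * M + V) * (d / effN N) := by field_simp; ring

end UpperRecursion

end UpperRecursion

section MomentUpperRecursion

variable {ι : Type*} {lam : ι → ℝ} {γ α V : ℝ} {N : ℕ} {S : ℕ → ι → ℝ≥0∞}

/-- The form of `UpperRecursion` satisfied by second moments `S t i` that are not yet known to be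
finite. -/
def MomentUpperRecursion (lam : ι → ℝ) (γ : ℝ) (N : ℕ) (α V : ℝ) (S : ℕ → ι → ℝ≥0∞) : Prop :=
  ∀ t < N, ∀ i, S (t + 1) i ≤ ENNReal.ofReal ((1 - stepsize γ N t * lam i) ^ 2) * S t i +
    ENNReal.ofReal (2 * stepsize γ N t ^ 2 * lam i) *
      (ENNReal.ofReal α * ∑' j, ENNReal.ofReal (lam j) * S t j + ENNReal.ofReal V)

lemma ofReal_energy_toReal (hl : ∀ i, 0 ≤ lam i) {s : ι → ℝ≥0∞} (hs : ∀ i, s i ≠ ∞)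
    (hsum : Summable fun i => lam i * (s i).toReal) :
    ENNReal.ofReal (energy lam fun i => (s i).toReal) = ∑' i, ENNReal.ofReal (lam i) * s i := by
  rw [energy, ENNReal.ofReal_tsum_of_nonneg (fun i => mul_nonneg (hl i) ENNReal.toReal_nonneg) hsum]
  exact tsum_congr fun i => by rw [ENNReal.ofReal_mul (hl i), ENNReal.ofReal_toReal (hs i)]

lemma tsum_ofReal_ne_top_of_summable (hl : ∀ i, 0 ≤ lam i) (hsum : Summable lam) :
    ∑' i, ENNReal.ofReal (lam i) ≠ ∞ := by
  rw [← ENNReal.ofReal_tsum_of_nonneg hl hsum]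
  exact ENNReal.ofReal_ne_top

lemma tsum_ofReal_mul_ne_top (hl : ∀ i, 0 ≤ lam i) (hsum : Summable lam) {s : ι → ℝ≥0∞}
    (hs : ∑' i, s i ≠ ∞) : ∑' i, ENNReal.ofReal (lam i) * s i ≠ ∞ := by
  refine ne_top_of_le_ne_top (ENNReal.mul_ne_top (tsum_ofReal_ne_top_of_summable hl hsum) hs) ?_
  rw [← ENNReal.tsum_mul_left]
  exact ENNReal.tsum_le_tsum fun i => mul_le_mul_left (ENNReal.le_tsum i) _

lemma summable_splitWeights_mul {K : Set ι} {a : ℝ} {f : ι → ℝ} (hf : Summable f)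
    (hlf : Summable fun i => lam i * f i) : Summable fun i => splitWeights lam K a i * f i := by
  classical
  refine (((hf.mul_left a).indicator K).add (hlf.indicator Kᶜ)).congr fun i => ?_
  by_cases hi : i ∈ K
  · simp [splitWeights_of_mem, hi]
  · simp [splitWeights_of_notMem, hi]

namespace MomentUpperRecursion

lemma tsum_ne_top (h : AdmissibleStepsize lam γ α) (hS : MomentUpperRecursion lam γ N α V S)
    (h0 : ∑' i, S 0 i ≠ ∞) {t : ℕ} (ht : t ≤ N) : ∑' i, S t i ≠ ∞ := by
  induction t with
  | zero => exact h0
  | succ t ih =>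
    have hprev := ih (Nat.le_of_succ_le ht)
    have henergy := tsum_ofReal_mul_ne_top h.eigenvalue_nonneg h.summable hprev
    have hnoise : ∑' i, ENNReal.ofReal (2 * stepsize γ N t ^ 2 * lam i) ≠ ∞ :=
      tsum_ofReal_ne_top_of_summable (fun i => mul_nonneg (by positivity) (h.eigenvalue_nonneg i))
        (h.summable.mul_left _)
    have hcontract : ∀ i, (1 - stepsize γ N t * lam i) ^ 2 ≤ 1 := fun i => by
      have hnonneg := stepsize_mul_nonneg (N := N) h.pos.le (h.eigenvalue_nonneg i) t
      have hle := (stepsize_mul_le (N := N) h.pos.le (h.eigenvalue_nonneg i) t).trans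
        (h.mul_eigenvalue_le_one i)
      exact pow_le_one₀ (sub_nonneg.2 hle) (sub_le_self _ hnonneg)
    refine ne_top_of_le_ne_top ?_ (ENNReal.tsum_le_tsum (hS t ht))
    rw [ENNReal.tsum_add, ENNReal.tsum_mul_right]
    exact ENNReal.add_ne_top.2 ⟨ne_top_of_le_ne_top hprev (ENNReal.tsum_le_tsum fun i =>
      mul_le_of_le_one_left' (ENNReal.ofReal_le_one.2 (hcontract i))),
      ENNReal.mul_ne_top hnoise (by finiteness)⟩

lemma upperRecursion_toReal (h : AdmissibleStepsize lam γ α)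
    (hS : MomentUpperRecursion lam γ N α V S) (hV : 0 ≤ V) (h0 : ∑' i, S 0 i ≠ ∞) :
    UpperRecursion lam γ N α V fun t i => (S t i).toReal where
  noise_nonneg := hV
  nonneg _ _ := ENNReal.toReal_nonneg
  summable _ ht := ENNReal.summable_toReal (hS.tsum_ne_top h h0 ht)
  succ_le t ht i := by
    have hfin := ENNReal.ne_top_of_tsum_ne_top (hS.tsum_ne_top h h0 ht.le)
    have hli := h.eigenvalue_nonneg i
    have hsum := summable_mul_of_summable_of_nonneg h.eigenvalue_nonneg
      (fun _ => ENNReal.toReal_nonneg) h.summable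
      (ENNReal.summable_toReal (hS.tsum_ne_top h h0 ht.le))
    have henergy : 0 ≤ α * energy lam fun j => (S t j).toReal :=
      mul_nonneg h.coeff_nonneg (energy_nonneg h.eigenvalue_nonneg fun _ => ENNReal.toReal_nonneg)
    refine ENNReal.toReal_le_of_le_ofReal (by positivity) ((hS t ht i).trans_eq ?_)
    rw [← ofReal_energy_toReal h.eigenvalue_nonneg hfin hsum, ← ENNReal.ofReal_mul h.coeff_nonneg,
      ← ENNReal.ofReal_add henergy hV, ← ENNReal.ofReal_mul (by positivity),
      ENNReal.ofReal_add (by positivity) (by positivity), ENNReal.ofReal_mul (sq_nonneg _),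
      ENNReal.ofReal_toReal (hfin i)]

lemma coord_le (hN : 1 < N) (h : AdmissibleStepsize lam γ α)
    (hS : MomentUpperRecursion lam γ N α V S) (hV : 0 ≤ V) (h0 : ∑' i, S 0 i ≠ ∞) (K : Set ι)
    (i : ι) :
    ENNReal.ofReal (lam i) * S N i ≤
      ENNReal.ofReal (lam i * decay γ N (lam i) 0 ^ 2) * S 0 i + ENNReal.ofReal 128 *
        ((ENNReal.ofReal α *
            ∑' j, ENNReal.ofReal (splitWeights lam K (1 / (effN N * γ)) j) * S 0 j +
          ENNReal.ofReal V) * ENNReal.ofReal (effDimWeights lam γ N K i / effN N)) := by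
  have hs := hS.upperRecursion_toReal h hV h0
  have hli := h.eigenvalue_nonneg i
  have hweights : ∀ j, 0 ≤ splitWeights lam K (1 / (effN N * γ)) j := splitWeights_nonneg
    h.eigenvalue_nonneg (one_div_nonneg.2 (mul_nonneg effN_nonneg h.pos.le))
  have hK : Summable fun j => splitWeights lam K (1 / (effN N * γ)) j * (S 0 j).toReal :=
    summable_splitWeights_mul (hs.summable 0 N.zero_le) (hs.summable_energy h N.zero_le)
  have hfin : ∀ {t}, t ≤ N → ∀ j, S t j ≠ ∞ := fun ht =>
    ENNReal.ne_top_of_tsum_ne_top (hS.tsum_ne_top h h0 ht)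
  have hstart : 0 ≤ α * energy (splitWeights lam K (1 / (effN N * γ))) fun j => (S 0 j).toReal :=
    mul_nonneg h.coeff_nonneg (energy_nonneg hweights fun _ => ENNReal.toReal_nonneg)
  rw [← ENNReal.ofReal_toReal (hfin le_rfl i), ← ENNReal.ofReal_mul hli,
    ← ENNReal.ofReal_toReal (hfin N.zero_le i), ← ENNReal.ofReal_mul (by positivity),
    ← ofReal_energy_toReal hweights (hfin N.zero_le) hK, ← ENNReal.ofReal_mul h.coeff_nonneg,
    ← ENNReal.ofReal_add hstart hV, ← ENNReal.ofReal_mul (by positivity),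
    ← ENNReal.ofReal_mul (by norm_num), ← mul_assoc]
  exact (ENNReal.ofReal_le_ofReal (hs.coord_le hN h hK i)).trans ENNReal.ofReal_add_le

end MomentUpperRecursion

end MomentUpperRecursion

section LowerRecursion

variable {ι : Type*} {lam : ι → ℝ} {S : ℕ → ι → ℝ≥0∞} {N : ℕ} {γ β V : ℝ}

/-- The reverse of `UpperRecursion`, for the coordinate second moments of SGD; the values are in
`ℝ≥0∞` because these moments may be infinite. -/
def LowerRecursion (lam : ι → ℝ) (γ : ℝ) (N : ℕ) (β V : ℝ) (S : ℕ → ι → ℝ≥0∞) : Prop :=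
  ∀ t < N, ∀ i, ENNReal.ofReal ((1 - stepsize γ N t * lam i) ^ 2) * S t i +
    ENNReal.ofReal (stepsize γ N t ^ 2 * lam i) *
      (ENNReal.ofReal β * ∑' j, ENNReal.ofReal (lam j) * S t j + ENNReal.ofReal V) ≤ S (t + 1) i

namespace LowerRecursion

lemma decay_sq_mul_le (hS : LowerRecursion lam γ N β V S) (hγ : 0 ≤ γ) {i : ι} (hl : 0 ≤ lam i)
    (hγl : γ * lam i ≤ 1) {t : ℕ} (ht : t ≤ N) :
    ENNReal.ofReal (decay γ N (lam i) 0 ^ 2) * S 0 i ≤ S t i := by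
  have hunroll := unroll_le (s := fun t => S t i) (b := 0)
    (c := fun r => ENNReal.ofReal ((1 - stepsize γ N r * lam i) ^ 2)) (fun _ => zero_le)
    fun r hr => (add_le_add_right zero_le _).trans (hS r (hr.trans_le ht) i)
  refine le_trans ?_ (le_self_add.trans hunroll)
  rw [← ENNReal.ofReal_prod_of_nonneg fun _ _ => sq_nonneg _, Finset.prod_pow,
    decay_eq_prod_mul t.zero_le ht]
  have hprod : 0 ≤ ∏ r ∈ Finset.Ico 0 t, (1 - stepsize γ N r * lam i) :=
    Finset.prod_nonneg fun r _ => by linarith [stepsize_mul_le (N := N) hγ hl r]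
  refine mul_le_mul_left (ENNReal.ofReal_le_ofReal (pow_le_pow_left₀
    (mul_nonneg hprod (decay_nonneg hγ hl hγl t)) ?_ 2)) _
  exact mul_le_of_le_one_right hprod (decay_le_one hγ hl hγl ht)

lemma exp_mul_tail_energy_le (hN : 1 < N) (hS : LowerRecursion lam γ N β V S) (hγ : 0 < γ)
    (hl : ∀ i, 0 ≤ lam i) (hγl : ∀ i, γ * lam i ≤ 1 / 2) {t : ℕ} (ht : t ≤ N) :
    ENNReal.ofReal (Real.exp (-16)) *
        ∑' i, ENNReal.ofReal (splitWeights lam (optSet lam γ N) 0 i) * S 0 i ≤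
      ∑' i, ENNReal.ofReal (lam i) * S t i := by
  rw [← ENNReal.tsum_mul_left]
  refine ENNReal.tsum_le_tsum fun i => ?_
  by_cases hi : i ∈ optSet lam γ N
  · simp only [splitWeights_of_mem hi, ENNReal.ofReal_zero, zero_mul, mul_zero, zero_le]
  · rw [splitWeights_of_notMem hi, mul_left_comm]
    gcongr
    refine le_trans ?_ (hS.decay_sq_mul_le hγ.le (hl i) (by linarith [hγl i]) ht)
    gcongr
    have hsmall : effN N * (stepsize γ N 0 * lam i) ≤ 1 := by
      rw [stepsize_zero]
      exact (not_le.1 fun h => hi ((mem_optSet_iff hN hγ).2 h)).le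
    calc Real.exp (-16) = Real.exp (-8) ^ 2 := by rw [← Real.exp_nat_mul]; norm_num
      _ ≤ decay γ N (lam i) 0 ^ 2 := pow_le_pow_left₀ (Real.exp_pos _).le
          (exp_le_decay hN hγ.le (hl i) (hγl i) hsmall) 2

lemma decay_sq_add_sum_noiseGain_sq_le (hS : LowerRecursion lam γ N β V S) {A : ℝ≥0∞}
    (hA : ∀ t < N, A ≤ ENNReal.ofReal β * ∑' j, ENNReal.ofReal (lam j) * S t j + ENNReal.ofReal V)
    {i : ι} (hl : 0 ≤ lam i) :
    ENNReal.ofReal (lam i * decay γ N (lam i) 0 ^ 2) * S 0 i +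
        ENNReal.ofReal (∑ t ∈ Finset.range N, noiseGain γ N (lam i) t ^ 2) * A ≤
      ENNReal.ofReal (lam i) * S N i := by
  have hunroll := unroll_le (s := fun t => S t i)
    (b := fun t => ENNReal.ofReal (stepsize γ N t ^ 2 * lam i) * A)
    (c := fun r => ENNReal.ofReal ((1 - stepsize γ N r * lam i) ^ 2)) (fun _ => zero_le)
    fun t ht => (add_le_add_right (mul_le_mul_right (hA t ht) _) _).trans (hS t ht i)
  simp only [← ENNReal.ofReal_prod_of_nonneg fun _ _ => sq_nonneg _, Finset.prod_pow] at hunroll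
  refine le_trans (le_of_eq ?_) (mul_le_mul_right hunroll (ENNReal.ofReal (lam i)))
  rw [mul_add, ← mul_assoc, ENNReal.ofReal_mul hl,
    ENNReal.ofReal_sum_of_nonneg fun _ _ => sq_nonneg _, Finset.sum_mul, Finset.mul_sum]
  congr 1
  refine Finset.sum_congr rfl fun t _ => ?_
  rw [← mul_assoc, ← mul_assoc, ← ENNReal.ofReal_mul hl, ← ENNReal.ofReal_mul (by positivity),
    noiseGain, decay]
  ring_nf

lemma le_coord (hN : 1 < N) (hS : LowerRecursion lam γ N β V S) (hγ : 0 < γ)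
    (hl : ∀ i, 0 ≤ lam i) (hγl : ∀ i, γ * lam i ≤ 1 / 4) (i : ι) :
    ENNReal.ofReal (lam i * decay γ N (lam i) 0 ^ 2) * S 0 i +
        ENNReal.ofReal (Real.exp (-32) / 32) *
          ((ENNReal.ofReal β *
              ∑' j, ENNReal.ofReal (splitWeights lam (optSet lam γ N) 0 j) * S 0 j +
            ENNReal.ofReal V) *
          ENNReal.ofReal (effDimWeights lam γ N (optSet lam γ N) i / effN N)) ≤
      ENNReal.ofReal (lam i) * S N i := by
  set T := ∑' j, ENNReal.ofReal (splitWeights lam (optSet lam γ N) 0 j) * S 0 j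
  set q := effDimWeights lam γ N (optSet lam γ N) i / effN N
  have hexp : ENNReal.ofReal (Real.exp (-32) / 32) =
      ENNReal.ofReal (Real.exp (-16)) * ENNReal.ofReal (Real.exp (-16) / 32) := by
    rw [← ENNReal.ofReal_mul (Real.exp_pos _).le, mul_div_assoc', ← Real.exp_add]
    norm_num
  have hA : ∀ t < N, ENNReal.ofReal (Real.exp (-16)) * (ENNReal.ofReal β * T + ENNReal.ofReal V) ≤
      ENNReal.ofReal β * ∑' j, ENNReal.ofReal (lam j) * S t j + ENNReal.ofReal V := fun t ht => by
    rw [mul_add, mul_left_comm]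
    gcongr
    · exact hS.exp_mul_tail_energy_le hN hγ hl (fun j => (hγl j).trans (by norm_num)) ht.le
    · exact mul_le_of_le_one_left' (ENNReal.ofReal_le_one.2 (Real.exp_le_one_iff.2 (by norm_num)))
  refine le_trans (add_le_add_right ?_ _) (hS.decay_sq_add_sum_noiseGain_sq_le hA (hl i))
  calc ENNReal.ofReal (Real.exp (-32) / 32) *
        ((ENNReal.ofReal β * T + ENNReal.ofReal V) * ENNReal.ofReal q)
      = ENNReal.ofReal (Real.exp (-16) / 32 * q) *
        (ENNReal.ofReal (Real.exp (-16)) * (ENNReal.ofReal β * T + ENNReal.ofReal V)) := by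
        rw [hexp, ENNReal.ofReal_mul (by positivity)]
        ring
    _ ≤ _ := by
        gcongr
        exact effDimWeights_optSet_le_sum_noiseGain_sq hN hγ (hl i) (hγl i)

end LowerRecursion

end LowerRecursion

section Operators

variable {E : Type*} [NormedAddCommGroup E] [InnerProductSpace ℝ E]

lemma outer_apply (x u : E) : outer x u = inner ℝ x u • x := rfl

lemma norm_outer (x : E) : ‖outer x‖ = ‖x‖ ^ 2 := by
  simp [outer, sq]

lemma continuous_outer : Continuous (outer : E → E →L[ℝ] E) :=
  (InnerProductSpace.rankOne ℝ).continuous.clm_apply continuous_id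

lemma inner_outer_apply (x a b : E) : inner ℝ a (outer x b) = inner ℝ a x * inner ℝ b x := by
  rw [outer_apply, inner_smul_right, real_inner_comm b x, mul_comm]

lemma inner_outer_comp_outer_comp_outer (x u a : E) :
    inner ℝ a ((outer x ∘L outer u ∘L outer x) a) = (inner ℝ u x * inner ℝ a x) ^ 2 := by
  simp only [ContinuousLinearMap.comp_apply, outer_apply, inner_smul_right]
  rw [real_inner_comm a x, real_inner_comm u x]
  ring

lemma continuous_quad (A : E →L[ℝ] E) : Continuous (quad A) :=
  continuous_id.inner A.continuous

lemma quad_smul (A : E →L[ℝ] E) (r : ℝ) (u : E) : quad A (r • u) = r ^ 2 * quad A u := by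
  simp only [quad, map_smul, real_inner_smul_left, real_inner_smul_right]
  ring

variable {ι : Type*} (v : HilbertBasis ι ℝ E)

lemma opTrace_comp_outer (T : E →L[ℝ] E) (u : E) : opTrace v (T ∘L outer u) = quad T u := by
  rw [quad, ← v.tsum_inner_mul_inner u (T u), opTrace]
  refine tsum_congr fun i => ?_
  rw [ContinuousLinearMap.comp_apply, outer_apply, map_smul, real_inner_smul_right]

variable {v} {A : E →L[ℝ] E} {lam : ι → ℝ}

lemma quad_basis (hv : ∀ i, A (v i) = lam i • v i) (i : ι) : quad A (v i) = lam i := by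
  rw [quad, hv, real_inner_smul_right, real_inner_self_eq_norm_sq, v.orthonormal.1 i, one_pow,
    mul_one]

lemma opTrace_eq_tsum (hv : ∀ i, A (v i) = lam i • v i) : opTrace v A = ∑' i, lam i :=
  tsum_congr fun i => quad_basis hv i

lemma inner_basis_apply (hv : ∀ i, A (v i) = lam i • v i) (i : ι) (u : E) :
    inner ℝ (v i) (A u) = lam i * inner ℝ (v i) u := by
  have hsum := ((innerSL ℝ (v i)) ∘L A).hasSum (v.hasSum_repr u)
  have hcoord : ∀ j, ((innerSL ℝ (v i)) ∘L A) (v.repr u j • v j) =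
      lam j * inner ℝ (v j) u * inner ℝ (v i) (v j) := fun j => by
    rw [map_smul, ContinuousLinearMap.comp_apply, innerSL_apply_apply, hv, real_inner_smul_right,
      v.repr_apply_apply, smul_eq_mul]
    ring
  simp only [hcoord] at hsum
  have hsingle := hasSum_single (f := fun j => lam j * inner ℝ (v j) u * inner ℝ (v i) (v j)) i
    fun j hj => by rw [v.orthonormal.2 hj.symm, mul_zero]
  rw [real_inner_self_eq_norm_sq, v.orthonormal.1 i, one_pow, mul_one] at hsingle
  exact hsum.unique hsingle

lemma hasSum_quad (hv : ∀ i, A (v i) = lam i • v i) (u : E) :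
    HasSum (fun i => lam i * inner ℝ (v i) u ^ 2) (quad A u) := by
  refine (v.hasSum_inner_mul_inner u (A u)).congr_fun fun i => ?_
  rw [inner_basis_apply hv, real_inner_comm u]
  ring

lemma specNormSq_eq {a : ι → ℝ} (ha : ∀ i, 0 ≤ a i) (u : E) :
    specNormSq v a u = ∑' i, ENNReal.ofReal (a i) * ENNReal.ofReal (inner ℝ (v i) u ^ 2) := by
  simp only [specNormSq, ENNReal.ofReal_mul (ha _)]

lemma ofReal_quad_eq_specNormSq (hv : ∀ i, A (v i) = lam i • v i) (hl : ∀ i, 0 ≤ lam i) (u : E) :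
    ENNReal.ofReal (quad A u) = specNormSq v lam u := by
  have hsum := hasSum_quad hv u
  rw [← hsum.tsum_eq, ENNReal.ofReal_tsum_of_nonneg (fun i => mul_nonneg (hl i) (sq_nonneg _))
    hsum.summable, specNormSq]

lemma inner_basis_contraction (hv : ∀ i, A (v i) = lam i • v i) (γ : ℝ) (N : ℕ) (u : E) (i : ι) :
    inner ℝ (v i) (contraction A γ N u) = decay γ N (lam i) 0 * inner ℝ (v i) u := by
  have hprod : ∀ l : List ℕ, inner ℝ (v i) ((l.map fun t => 1 - stepsize γ N t • A).prod u) =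
      (l.map fun t => 1 - stepsize γ N t * lam i).prod * inner ℝ (v i) u := by
    intro l
    induction l with
    | nil => simp
    | cons t l ih =>
      rw [List.map_cons, List.prod_cons, List.map_cons, List.prod_cons, mul_assoc, ← ih,
        mul_apply_eq_comp, sub_apply, inner_sub_right, smul_apply, real_inner_smul_right,
        inner_basis_apply hv, one_apply_eq_self]
      ring
  rw [contraction, hprod, decay, ← Finset.range_eq_Ico]
  rfl

end Operators

section Covariance

variable {E : Type*} [NormedAddCommGroup E] [InnerProductSpace ℝ E] [MeasurableSpace E]
  {D : Measure (E × ℝ)}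

lemma integrable_outer (hx : MemLp (fun p : E × ℝ => p.1) 2 D) :
    Integrable (fun p : E × ℝ => outer p.1) D := by
  refine ((memLp_two_iff_integrable_sq_norm hx.1).1 hx).mono'
    (continuous_outer.comp_aestronglyMeasurable hx.1) (Filter.Eventually.of_forall fun p => ?_)
  rw [norm_outer]

lemma integrable_outer_comp_outer (hx : MemLp (fun p : E × ℝ => p.1) 4 D) (A : E →L[ℝ] E) :
    Integrable (fun p : E × ℝ => outer p.1 ∘L A ∘L outer p.1) D := by
  have hcont : Continuous fun x : E => outer x ∘L A ∘L outer x :=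
    continuous_outer.clm_comp (continuous_const.clm_comp continuous_outer)
  have hpow : Integrable (fun p : E × ℝ => ‖p.1‖ ^ 4) D :=
    hx.integrable_norm_pow (by norm_num)
  refine (hpow.mul_const ‖A‖).mono' (hcont.comp_aestronglyMeasurable hx.1)
    (Filter.Eventually.of_forall fun p => ?_)
  calc ‖outer p.1 ∘L A ∘L outer p.1‖
      ≤ ‖outer p.1‖ * (‖A‖ * ‖outer p.1‖) :=
        (ContinuousLinearMap.opNorm_comp_le _ _).trans
          (mul_le_mul_of_nonneg_left (ContinuousLinearMap.opNorm_comp_le _ _) (norm_nonneg _))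
    _ = ‖p.1‖ ^ 4 * ‖A‖ := by rw [norm_outer]; ring

lemma memLp_inner_mul_inner (hx : MemLp (fun p : E × ℝ => p.1) 4 D) (a b : E) :
    MemLp (fun p : E × ℝ => inner ℝ a p.1 * inner ℝ b p.1) 2 D := by
  have : ENNReal.HolderTriple 4 4 2 := ⟨by
    rw [← ENNReal.toReal_eq_toReal_iff' (by simp) (by simp),
      ENNReal.toReal_add (by simp) (by simp)]
    norm_num⟩
  exact (hx.const_inner b).mul (hx.const_inner a)

section

variable [CompleteSpace E]

lemma inner_integral_apply {T : E × ℝ → E →L[ℝ] E} (hT : Integrable T D) (a b : E) :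
    inner ℝ a ((∫ p, T p ∂D) b) = ∫ p, inner ℝ a (T p b) ∂D := by
  rw [ContinuousLinearMap.integral_apply hT]
  exact ((innerSL ℝ a).integral_comp_comm (hT.apply_continuousLinearMap b)).symm

lemma inner_cov (hx : MemLp (fun p : E × ℝ => p.1) 2 D) (a b : E) :
    inner ℝ a (cov D b) = ∫ p, inner ℝ a p.1 * inner ℝ b p.1 ∂D := by
  simp only [cov, inner_integral_apply (integrable_outer hx), inner_outer_apply]

lemma inner_cov_comm (hx : MemLp (fun p : E × ℝ => p.1) 2 D) (a b : E) :
    inner ℝ a (cov D b) = inner ℝ b (cov D a) := by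
  simp only [inner_cov hx, mul_comm]

lemma quad_cov (hx : MemLp (fun p : E × ℝ => p.1) 2 D) (a : E) :
    quad (cov D) a = ∫ p, inner ℝ a p.1 ^ 2 ∂D := by
  simp only [quad, inner_cov hx, sq]

lemma quad_cov_nonneg (hx : MemLp (fun p : E × ℝ => p.1) 2 D) (a : E) : 0 ≤ quad (cov D) a := by
  rw [quad_cov hx]
  exact integral_nonneg fun p => sq_nonneg _

variable {ι : Type*} {v : HilbertBasis ι ℝ E} {lam : ι → ℝ}

lemma eigenvalue_nonneg (hx : MemLp (fun p : E × ℝ => p.1) 2 D)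
    (hv : ∀ i, cov D (v i) = lam i • v i) (i : ι) : 0 ≤ lam i :=
  quad_basis hv i ▸ quad_cov_nonneg hx (v i)

lemma summable_eigenvalues (hx : MemLp (fun p : E × ℝ => p.1) 2 D)
    (hv : ∀ i, cov D (v i) = lam i • v i) : Summable lam := by
  have hint : ∀ i, Integrable (fun p : E × ℝ => inner ℝ (v i) p.1 ^ 2) D := fun i =>
    (hx.const_inner (v i)).integrable_sq
  refine summable_of_sum_le (c := ∫ p, ‖p.1‖ ^ 2 ∂D) (eigenvalue_nonneg hx hv) fun s => ?_
  calc ∑ i ∈ s, lam i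
      = ∫ p, ∑ i ∈ s, inner ℝ (v i) p.1 ^ 2 ∂D := by
        rw [integral_finsetSum s fun i _ => hint i]
        exact Finset.sum_congr rfl fun i _ => by rw [← quad_cov hx, quad_basis hv]
    _ ≤ ∫ p, ‖p.1‖ ^ 2 ∂D := by
        refine integral_mono (integrable_finsetSum s fun i _ => hint i)
          ((memLp_two_iff_integrable_sq_norm hx.1).1 hx) fun p => ?_
        simpa only [Real.norm_eq_abs, sq_abs] using
          v.orthonormal.sum_inner_products_le (x := p.1) (s := s)

lemma FourthMomentUpper.integral_inner_mul_inner_sq_le {α : ℝ} (hα : FourthMomentUpper D v α)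
    (hx : MemLp (fun p : E × ℝ => p.1) 4 D) (u a : E) :
    ∫ p, (inner ℝ u p.1 * inner ℝ a p.1) ^ 2 ∂D ≤ α * quad (cov D) u * quad (cov D) a := by
  have h := ((ContinuousLinearMap.le_def _ _).1
    (hα (outer u) (InnerProductSpace.isPositive_rankOne_self u))).inner_nonneg_right a
  rw [sub_apply, inner_sub_right, inner_integral_apply (integrable_outer_comp_outer hx _),
    smul_apply, real_inner_smul_right, sub_nonneg, opTrace_comp_outer] at h
  simpa only [inner_outer_comp_outer_comp_outer, quad] using h

lemma FourthMomentLower.le_integral_inner_mul_inner_sq {β : ℝ} (hβ : FourthMomentLower D v β)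
    [IsFiniteMeasure D] (hx : MemLp (fun p : E × ℝ => p.1) 4 D) (u a : E) :
    inner ℝ u (cov D a) ^ 2 + β * quad (cov D) u * quad (cov D) a ≤
      ∫ p, (inner ℝ u p.1 * inner ℝ a p.1) ^ 2 ∂D := by
  have hx2 : MemLp (fun p : E × ℝ => p.1) 2 D := hx.mono_exponent (by norm_num)
  have hcov : inner ℝ a ((cov D ∘L outer u ∘L cov D) a) = inner ℝ u (cov D a) ^ 2 := by
    rw [ContinuousLinearMap.comp_apply, ContinuousLinearMap.comp_apply, outer_apply, map_smul,
      real_inner_smul_right, inner_cov_comm hx2 a u, sq]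
  have h := ((ContinuousLinearMap.le_def _ _).1
    (hβ (outer u) (InnerProductSpace.isPositive_rankOne_self u))).inner_nonneg_right a
  rw [sub_apply, inner_sub_right, sub_apply, inner_sub_right,
    inner_integral_apply (integrable_outer_comp_outer hx _), smul_apply, real_inner_smul_right,
    sub_nonneg, opTrace_comp_outer, hcov] at h
  simp only [inner_outer_comp_outer_comp_outer] at h
  exact add_comm (inner ℝ u (cov D a) ^ 2) _ ▸ le_sub_iff_add_le.1 h

lemma FourthMomentUpper.one_le [IsProbabilityMeasure D] {α : ℝ} (hα : FourthMomentUpper D v α)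
    (hx : MemLp (fun p : E × ℝ => p.1) 4 D) {a : E} (ha : 0 < quad (cov D) a) : 1 ≤ α := by
  have hx2 : MemLp (fun p : E × ℝ => p.1) 2 D := hx.mono_exponent (by norm_num)
  have hjensen : quad (cov D) a ^ 2 ≤ ∫ p, (inner ℝ a p.1 * inner ℝ a p.1) ^ 2 ∂D := by
    have hvar := variance_nonneg (fun p : E × ℝ => inner ℝ a p.1 * inner ℝ a p.1) D
    rw [variance_eq_sub (memLp_inner_mul_inner hx a a), ← inner_cov hx2, sub_nonneg] at hvar
    exact hvar
  have hle := hjensen.trans (hα.integral_inner_mul_inner_sq_le hx a a)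
  rw [mul_assoc, ← sq] at hle
  exact (le_mul_iff_one_le_left (pow_pos ha 2)).1 hle

end

end Covariance

lemma integral_sub_sq {Ω : Type*} [MeasurableSpace Ω] {μ : Measure Ω} {X Y : Ω → ℝ}
    (hX : MemLp X 2 μ) (hY : MemLp Y 2 μ) :
    ∫ ω, (X ω - Y ω) ^ 2 ∂μ = ∫ ω, X ω ^ 2 ∂μ - 2 * ∫ ω, X ω * Y ω ∂μ + ∫ ω, Y ω ^ 2 ∂μ := by
  have hcross : Integrable (fun ω => 2 * X ω * Y ω) μ := by
    simpa only [mul_assoc, Pi.mul_apply] using (hX.integrable_mul hY).const_mul 2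
  have hdiff : Integrable (fun ω => X ω ^ 2 - 2 * X ω * Y ω) μ := hX.integrable_sq.sub hcross
  simp only [sub_sq]
  rw [integral_add hdiff hY.integrable_sq, integral_sub hX.integrable_sq hcross]
  simp only [mul_assoc, integral_const_mul]

section Residual

variable {E : Type*} [NormedAddCommGroup E] [InnerProductSpace ℝ E]

/-- The residual `y - ⟪w*, x⟫` of the reference parameter at the sample `p = (x, y)`. -/
noncomputable def residual (wstar : E) (p : E × ℝ) : ℝ := p.2 - inner ℝ wstar p.1

lemma inner_residual_sq_smul_outer_apply (wstar a : E) (p : E × ℝ) :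
    inner ℝ a (((p.2 - inner ℝ wstar p.1) ^ 2 • outer p.1) a) =
      (residual wstar p * inner ℝ a p.1) ^ 2 := by
  rw [smul_apply, real_inner_smul_right, inner_outer_apply, residual]
  ring

variable [MeasurableSpace E] {D : Measure (E × ℝ)} {wstar : E} {σ : ℝ}

lemma Model.memLp_covariate_two [IsFiniteMeasure D] (hm : Model D wstar) :
    MemLp (fun p : E × ℝ => p.1) 2 D :=
  hm.covariate.mono_exponent (by norm_num)

lemma Model.memLp_residual [IsFiniteMeasure D] (hm : Model D wstar) :
    MemLp (residual wstar) 2 D :=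
  hm.response.sub (hm.memLp_covariate_two.const_inner wstar)

lemma Model.excessRisk_add [CompleteSpace E] [IsFiniteMeasure D] (hm : Model D wstar) (a : E) :
    excessRisk D wstar (wstar + a) =
      1 / 2 * quad (cov D) a - ∫ p, residual wstar p * inner ℝ a p.1 ∂D := by
  have hshift : ∀ p : E × ℝ, p.2 - inner ℝ (wstar + a) p.1 = residual wstar p - inner ℝ a p.1 :=
    fun p => by rw [residual, inner_add_left]; ring
  have hrisk : risk D wstar = 1 / 2 * ∫ p, residual wstar p ^ 2 ∂D := rfl
  rw [excessRisk, hrisk, risk]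
  simp only [hshift]
  rw [integral_sub_sq hm.memLp_residual (hm.memLp_covariate_two.const_inner a),
    ← quad_cov hm.memLp_covariate_two]
  ring

lemma Model.integral_residual_mul_inner [CompleteSpace E] [IsFiniteMeasure D]
    (hm : Model D wstar) (a : E) : ∫ p, residual wstar p * inner ℝ a p.1 ∂D = 0 := by
  have hnonneg : ∀ r : ℝ, 0 ≤ 1 / 2 * quad (cov D) a * (r * r) +
      -(∫ p, residual wstar p * inner ℝ a p.1 ∂D) * r + 0 := fun r => by
    have hmin : 0 ≤ excessRisk D wstar (wstar + r • a) := sub_nonneg.2 (hm.minimizer _)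
    rw [hm.excessRisk_add, quad_smul] at hmin
    simp only [real_inner_smul_left, mul_left_comm _ r, integral_const_mul] at hmin
    linarith
  have hdiscrim := discrim_le_zero hnonneg
  rw [discrim, mul_zero, sub_zero, neg_sq] at hdiscrim
  exact pow_eq_zero_iff two_ne_zero |>.1 (le_antisymm hdiscrim (sq_nonneg _))

lemma Model.excessRisk_eq [CompleteSpace E] [IsFiniteMeasure D] (hm : Model D wstar) (w : E) :
    excessRisk D wstar w = 1 / 2 * quad (cov D) (w - wstar) := by
  have h := hm.excessRisk_add (w - wstar)
  rwa [add_sub_cancel, hm.integral_residual_mul_inner, sub_zero] at h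

lemma NoiseCondition.memLp_residual_mul_inner [IsFiniteMeasure D] (hn : NoiseCondition D wstar σ)
    (hm : Model D wstar) (a : E) :
    MemLp (fun p => residual wstar p * inner ℝ a p.1) 2 D := by
  have hmeas : AEStronglyMeasurable (fun p => residual wstar p * inner ℝ a p.1) D :=
    hm.memLp_residual.1.mul (hm.covariate.const_inner a).1
  rw [memLp_two_iff_integrable_sq hmeas]
  simpa only [innerSL_apply_apply, inner_residual_sq_smul_outer_apply] using
    (innerSL ℝ a).integrable_comp (hn.1.apply_continuousLinearMap a)

lemma NoiseCondition.integral_residual_mul_inner_sq_le [CompleteSpace E]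
    (hn : NoiseCondition D wstar σ) (a : E) :
    ∫ p, (residual wstar p * inner ℝ a p.1) ^ 2 ∂D ≤ σ ^ 2 * quad (cov D) a := by
  have h := ((ContinuousLinearMap.le_def _ _).1 hn.2).inner_nonneg_right a
  rw [sub_apply, inner_sub_right, inner_integral_apply hn.1, smul_apply, real_inner_smul_right,
    sub_nonneg] at h
  simpa only [inner_residual_sq_smul_outer_apply, quad] using h

namespace WellSpecifiedNoise

lemma hasLaw_residual (hw : WellSpecifiedNoise D wstar σ) :
    HasLaw (residual wstar) (gaussianReal 0 (Real.toNNReal (σ ^ 2))) D := hw.1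

lemma integral_residual (hw : WellSpecifiedNoise D wstar σ) : ∫ p, residual wstar p ∂D = 0 := by
  rw [hw.hasLaw_residual.integral_eq, integral_id_gaussianReal]

lemma integral_residual_sq (hw : WellSpecifiedNoise D wstar σ) :
    ∫ p, residual wstar p ^ 2 ∂D = σ ^ 2 := by
  have hvar := hw.hasLaw_residual.variance_eq
  simpa only [variance_eq_integral hw.hasLaw_residual.aemeasurable, hw.integral_residual, sub_zero,
    variance_id_gaussianReal, Real.coe_toNNReal _ (sq_nonneg σ)] using hvar

lemma indepFun_residual_comp (hw : WellSpecifiedNoise D wstar σ) {f : ℝ → ℝ} {g : E → ℝ}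
    (hf : Measurable f) (hg : Measurable g) :
    IndepFun (fun p => f (residual wstar p)) (fun p => g p.1) D :=
  hw.2.symm.comp hf hg

variable [BorelSpace E]

lemma memLp_residual_mul_inner [IsFiniteMeasure D] (hw : WellSpecifiedNoise D wstar σ)
    (hm : Model D wstar) (a : E) :
    MemLp (fun p => residual wstar p * inner ℝ a p.1) 2 D := by
  have ha : MemLp (fun p : E × ℝ => inner ℝ a p.1) 2 D := hm.memLp_covariate_two.const_inner a
  have hmeas : AEStronglyMeasurable (fun p => residual wstar p * inner ℝ a p.1) D :=
    hm.memLp_residual.1.mul ha.1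
  rw [memLp_two_iff_integrable_sq hmeas]
  simp only [mul_pow]
  exact (hw.indepFun_residual_comp (f := fun r => r ^ 2) (g := fun x => inner ℝ a x ^ 2)
    (by fun_prop) (by fun_prop)).integrable_mul hm.memLp_residual.integrable_sq ha.integrable_sq

lemma integral_residual_mul_inner_sq [CompleteSpace E] [IsFiniteMeasure D]
    (hw : WellSpecifiedNoise D wstar σ) (hm : Model D wstar) (a : E) :
    ∫ p, (residual wstar p * inner ℝ a p.1) ^ 2 ∂D = σ ^ 2 * quad (cov D) a := by
  have hind := hw.indepFun_residual_comp (f := fun r => r ^ 2) (g := fun x => inner ℝ a x ^ 2)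
    (by fun_prop) (by fun_prop)
  simp only [mul_pow]
  rw [hind.integral_fun_mul_eq_mul_integral (hm.memLp_residual.1.pow 2)
    ((hm.covariate.const_inner a).1.pow 2), hw.integral_residual_sq,
    quad_cov hm.memLp_covariate_two]

lemma integral_residual_mul_inner_mul_inner_sq [IsFiniteMeasure D]
    (hw : WellSpecifiedNoise D wstar σ) (hm : Model D wstar) (a u : E) :
    ∫ p, residual wstar p * (inner ℝ u p.1 * inner ℝ a p.1 ^ 2) ∂D = 0 := by
  have hind := hw.indepFun_residual_comp (f := id) (g := fun x => inner ℝ u x * inner ℝ a x ^ 2)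
    measurable_id (by fun_prop)
  exact (hind.integral_fun_mul_eq_mul_integral hm.memLp_residual.1
    ((hm.covariate.const_inner u).1.mul ((hm.covariate.const_inner a).1.pow 2))).trans
    (mul_eq_zero_of_left hw.integral_residual _)

end WellSpecifiedNoise

end Residual

section ErrorStep

variable {E : Type*} [NormedAddCommGroup E] [InnerProductSpace ℝ E]

/-- One SGD step with stepsize `g` and sample `p`, acting on the error `u = w - w*`. -/
noncomputable def errorStep (wstar : E) (g : ℝ) (u : E) (p : E × ℝ) : E :=
  u - (g * (inner ℝ u p.1 - residual wstar p)) • p.1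

lemma inner_errorStep (wstar : E) (g : ℝ) (a u : E) (p : E × ℝ) :
    inner ℝ a (errorStep wstar g u p) = inner ℝ a u -
      g * (inner ℝ u p.1 * inner ℝ a p.1 - residual wstar p * inner ℝ a p.1) := by
  rw [errorStep, inner_sub_right, real_inner_smul_right]
  ring

variable [MeasurableSpace E] {D : Measure (E × ℝ)} {wstar a : E} {σ l : ℝ}

lemma memLp_inner_errorStep [IsFiniteMeasure D] (hx : MemLp (fun p : E × ℝ => p.1) 4 D)
    (hr : MemLp (fun p => residual wstar p * inner ℝ a p.1) 2 D) (g : ℝ) (u : E) :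
    MemLp (fun p => inner ℝ a (errorStep wstar g u p)) 2 D := by
  simp only [inner_errorStep]
  exact (memLp_const (inner ℝ a u)).sub (((memLp_inner_mul_inner hx u a).sub hr).const_mul g)

variable [CompleteSpace E] [IsProbabilityMeasure D]

lemma Model.integral_inner_errorStep_sq (hm : Model D wstar)
    (hr : MemLp (fun p => residual wstar p * inner ℝ a p.1) 2 D) (ha : cov D a = l • a)
    (g : ℝ) (u : E) :
    ∫ p, inner ℝ a (errorStep wstar g u p) ^ 2 ∂D =
      (1 - 2 * (g * l)) * inner ℝ a u ^ 2 +
        g ^ 2 * ∫ p, (inner ℝ u p.1 * inner ℝ a p.1 - residual wstar p * inner ℝ a p.1) ^ 2 ∂D := by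
  have hq := memLp_inner_mul_inner hm.covariate u a
  have hmean : ∫ p, (inner ℝ u p.1 * inner ℝ a p.1 - residual wstar p * inner ℝ a p.1) ∂D =
      l * inner ℝ a u := by
    rw [integral_sub (hq.integrable one_le_two) (hr.integrable one_le_two),
      hm.integral_residual_mul_inner, ← inner_cov hm.memLp_covariate_two, ha,
      real_inner_smul_right, real_inner_comm a u, sub_zero]
  have hgradient : MemLp
      (fun p => g * (inner ℝ u p.1 * inner ℝ a p.1 - residual wstar p * inner ℝ a p.1)) 2 D :=
    (hq.sub hr).const_mul g
  simp only [inner_errorStep]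
  rw [integral_sub_sq (memLp_const _) hgradient]
  simp only [mul_pow, integral_const_mul, hmean, integral_const, probReal_univ,
    one_smul]
  ring

variable {ι : Type*} {v : HilbertBasis ι ℝ E}

lemma NoiseCondition.integral_inner_errorStep_sq_le (hn : NoiseCondition D wstar σ)
    (hm : Model D wstar) {α : ℝ} (hα : FourthMomentUpper D v α) (ha : cov D a = l • a)
    (g : ℝ) (u : E) :
    ∫ p, inner ℝ a (errorStep wstar g u p) ^ 2 ∂D ≤ (1 - g * l) ^ 2 * inner ℝ a u ^ 2 +
      2 * g ^ 2 * quad (cov D) a * (α * quad (cov D) u + σ ^ 2) := by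
  have hr := hn.memLp_residual_mul_inner hm a
  have hq := memLp_inner_mul_inner hm.covariate u a
  have hgradient :
      ∫ p, (inner ℝ u p.1 * inner ℝ a p.1 - residual wstar p * inner ℝ a p.1) ^ 2 ∂D ≤
        2 * (α * quad (cov D) u * quad (cov D) a) + 2 * (σ ^ 2 * quad (cov D) a) := by
    calc _ ≤ ∫ p, (2 * (inner ℝ u p.1 * inner ℝ a p.1) ^ 2 +
          2 * (residual wstar p * inner ℝ a p.1) ^ 2) ∂D :=
          integral_mono (hq.sub hr).integrable_sq
            ((hq.integrable_sq.const_mul 2).add (hr.integrable_sq.const_mul 2)) fun p => by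
              simpa only [Pi.sub_apply, sub_eq_add_neg, neg_sq, mul_add] using
                add_sq_le (a := inner ℝ u p.1 * inner ℝ a p.1)
                  (b := -(residual wstar p * inner ℝ a p.1))
      _ = 2 * ∫ p, (inner ℝ u p.1 * inner ℝ a p.1) ^ 2 ∂D +
          2 * ∫ p, (residual wstar p * inner ℝ a p.1) ^ 2 ∂D := by
          rw [integral_add (hq.integrable_sq.const_mul 2) (hr.integrable_sq.const_mul 2),
            integral_const_mul, integral_const_mul]
      _ ≤ _ := by
          gcongr
          exacts [hα.integral_inner_mul_inner_sq_le hm.covariate u a,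
            hn.integral_residual_mul_inner_sq_le a]
  rw [hm.integral_inner_errorStep_sq hr ha]
  nlinarith only [mul_le_mul_of_nonneg_left hgradient (sq_nonneg g),
    sq_nonneg (g * l * inner ℝ a u)]

lemma WellSpecifiedNoise.le_integral_inner_errorStep_sq [BorelSpace E]
    (hw : WellSpecifiedNoise D wstar σ) (hm : Model D wstar) {β : ℝ}
    (hβ : FourthMomentLower D v β) (ha : cov D a = l • a) (g : ℝ) (u : E) :
    (1 - g * l) ^ 2 * inner ℝ a u ^ 2 + g ^ 2 * quad (cov D) a * (β * quad (cov D) u + σ ^ 2) ≤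
      ∫ p, inner ℝ a (errorStep wstar g u p) ^ 2 ∂D := by
  have hr := hw.memLp_residual_mul_inner hm a
  have hcross :
      ∫ p, inner ℝ u p.1 * inner ℝ a p.1 * (residual wstar p * inner ℝ a p.1) ∂D = 0 := by
    rw [← hw.integral_residual_mul_inner_mul_inner_sq hm a u]
    exact integral_congr_ae (Filter.Eventually.of_forall fun p => by ring)
  have hfourth := hβ.le_integral_inner_mul_inner_sq hm.covariate u a
  rw [ha, real_inner_smul_right, real_inner_comm a u] at hfourth
  rw [hm.integral_inner_errorStep_sq hr ha,
    integral_sub_sq (memLp_inner_mul_inner hm.covariate u a) hr, hcross,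
    hw.integral_residual_mul_inner_sq hm]
  nlinarith only [mul_le_mul_of_nonneg_left hfourth (sq_nonneg g)]

end ErrorStep

section Independence

variable {Ω X Y : Type*} [MeasurableSpace Ω] [MeasurableSpace X] [MeasurableSpace Y]
  {P : Measure Ω} {Z : ℕ → Ω → X} {N t : ℕ}

lemma indepFun_of_dependsOn_past [Nonempty X] {φ : (ℕ → X) → Y} (hφ : Measurable φ)
    (hpast : DependsOn φ (Set.Iio t)) (hZ : ∀ r < N, AEMeasurable (Z r) P)
    (hind : iIndepFun (fun r : Fin N => Z r) P) (ht : t < N) :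
    IndepFun (fun ω => φ fun r => Z r ω) (Z t) P := by
  set now : Fin N := ⟨t, ht⟩
  let extend (y : Finset.Iio now → X) (r : ℕ) : X :=
    if h : r < t then y ⟨⟨r, h.trans ht⟩, Finset.mem_Iio.2 h⟩ else Classical.arbitrary X
  have hextend : Measurable extend := measurable_pi_lambda _ fun r => by
    by_cases h : r < t
    · simp only [extend, h, dif_pos, measurable_pi_apply]
    · simp only [extend, h, dif_neg, not_false_eq_true, measurable_const]
  have hfactor : (fun ω => φ fun r => Z r ω) =
      (φ ∘ extend) ∘ fun ω (r : Finset.Iio now) => Z r.1 ω :=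
    funext fun ω => hpast fun r hr => by simp only [extend, Set.mem_Iio.1 hr, dif_pos]
  rw [hfactor]
  exact (hind.indepFun_finset₀ (Finset.Iio now) {now} (by simp) fun r => hZ r r.2).comp
    (hφ.comp hextend) (measurable_pi_apply (⟨now, Finset.mem_singleton_self _⟩ :
      ({now} : Finset (Fin N))))

lemma lintegral_comp_prodMk_of_indepFun [IsProbabilityMeasure P] {D : Measure X}
    [SFinite D] {U : Ω → Y} {W : Ω → X} {f : Y × X → ℝ≥0∞} (hf : Measurable f)
    (hU : AEMeasurable U P) (hW : HasLaw W D P) (hind : IndepFun U W P) :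
    ∫⁻ ω, f (U ω, W ω) ∂P = ∫⁻ ω, ∫⁻ x, f (U ω, x) ∂D ∂P := by
  rw [← lintegral_map' hf.aemeasurable (hU.prodMk hW.aemeasurable),
    (indepFun_iff_map_prod_eq_prod_map_map hU hW.aemeasurable).1 hind, hW.map_eq,
    lintegral_prod _ hf.aemeasurable, lintegral_map' hf.lintegral_prod_right'.aemeasurable hU]

/-- The first `N` members of the sequence `Z` are independent samples of the distribution `D`. -/
structure IIDSamples (P : Measure Ω) (D : Measure X) (Z : ℕ → Ω → X) (N : ℕ) : Prop where
  hasLaw : ∀ t < N, HasLaw (Z t) D P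
  iIndepFun : iIndepFun (fun t : Fin N => Z t) P

end Independence

section SecondMoment

variable {E : Type*} [NormedAddCommGroup E] [InnerProductSpace ℝ E]

lemma countable_of_hilbertBasis [SecondCountableTopology E] {ι : Type*} (v : HilbertBasis ι ℝ E) :
    Countable ι := by
  rw [← Set.countable_univ_iff]
  refine Set.PairwiseDisjoint.countable_of_isOpen (s := fun i => Metric.ball (v i) (1 / 2)) ?_
    (fun i _ => Metric.isOpen_ball) fun i _ => ⟨v i, Metric.mem_ball_self (by norm_num)⟩
  intro i _ j _ hij
  have hdist : ‖v i - v j‖ ^ 2 = 2 := by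
    rw [norm_sub_sq_real, v.orthonormal.1 i, v.orthonormal.1 j, v.orthonormal.2 hij]
    norm_num
  refine Metric.ball_disjoint_ball ?_
  rw [dist_eq_norm]
  nlinarith [norm_nonneg (v i - v j)]

variable {Ω : Type*} [MeasurableSpace Ω]

/-- The second moment `𝔼 ⟪a, U⟫²` of the random vector `U` in the direction `a`, possibly
infinite. -/
noncomputable def secondMoment (P : Measure Ω) (a : E) (U : Ω → E) : ℝ≥0∞ :=
  ∫⁻ ω, ENNReal.ofReal (inner ℝ a (U ω) ^ 2) ∂P

variable [SecondCountableTopology E] [MeasurableSpace E] [BorelSpace E] {P : Measure Ω}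
  {U : Ω → E} {ι : Type*} {v : HilbertBasis ι ℝ E} {lam : ι → ℝ} {A : E →L[ℝ] E}

lemma lintegral_quad (hU : AEMeasurable U P) (hv : ∀ i, A (v i) = lam i • v i)
    (hl : ∀ i, 0 ≤ lam i) :
    ∫⁻ ω, ENNReal.ofReal (quad A (U ω)) ∂P =
      ∑' i, ENNReal.ofReal (lam i) * secondMoment P (v i) U := by
  have := countable_of_hilbertBasis v
  have hexpand : ∀ u, ENNReal.ofReal (quad A u) =
      ∑' i, ENNReal.ofReal (lam i) * ENNReal.ofReal (inner ℝ (v i) u ^ 2) := fun u =>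
    (ofReal_quad_eq_specNormSq hv hl u).trans (specNormSq_eq hl u)
  simp only [hexpand, secondMoment]
  rw [lintegral_tsum fun i => by fun_prop]
  exact tsum_congr fun i => lintegral_const_mul'' _ (by fun_prop)

lemma lintegral_inner_sq_add_quad [IsProbabilityMeasure P] (hU : AEMeasurable U P)
    (hv : ∀ i, A (v i) = lam i • v i) (hl : ∀ i, 0 ≤ lam i) (a : E) {c d k V : ℝ} (hc : 0 ≤ c)
    (hd : 0 ≤ d) (hk : 0 ≤ k) (hV : 0 ≤ V) :
    ∫⁻ ω, ENNReal.ofReal (c * inner ℝ a (U ω) ^ 2 + d * (k * quad A (U ω) + V)) ∂P =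
      ENNReal.ofReal c * secondMoment P a U + ENNReal.ofReal d *
        (ENNReal.ofReal k * ∑' j, ENNReal.ofReal (lam j) * secondMoment P (v j) U +
          ENNReal.ofReal V) := by
  have hquad : ∀ u, 0 ≤ quad A u := fun u =>
    (hasSum_quad hv u).nonneg fun i => mul_nonneg (hl i) (sq_nonneg _)
  have hmeas : AEMeasurable (fun ω => ENNReal.ofReal (quad A (U ω))) P :=
    ((continuous_quad A).measurable.comp_aemeasurable hU).ennreal_ofReal
  have hexpand : ∀ u, ENNReal.ofReal (c * inner ℝ a u ^ 2 + d * (k * quad A u + V)) =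
      ENNReal.ofReal c * ENNReal.ofReal (inner ℝ a u ^ 2) + ENNReal.ofReal d *
        (ENNReal.ofReal k * ENNReal.ofReal (quad A u) + ENNReal.ofReal V) := fun u => by
    have hkq := mul_nonneg hk (hquad u)
    rw [ENNReal.ofReal_add (by positivity) (by positivity), ENNReal.ofReal_mul hc,
      ENNReal.ofReal_mul hd, ENNReal.ofReal_add hkq hV, ENNReal.ofReal_mul hk]
  simp only [hexpand]
  rw [lintegral_add_left' (by fun_prop), lintegral_const_mul'' _ (by fun_prop),
    lintegral_const_mul'' _ (by fun_prop), lintegral_add_left' (by fun_prop),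
    lintegral_const_mul'' _ hmeas, lintegral_quad hU hv hl, lintegral_const, measure_univ, mul_one,
    secondMoment]

end SecondMoment

section Dynamics

variable {E : Type*} [NormedAddCommGroup E] [InnerProductSpace ℝ E] {Ω : Type*} {γ : ℝ} {N t : ℕ}
  {w₀ wstar : E}

lemma dependsOn_sgd (γ : ℝ) (N : ℕ) (w₀ : E) (t : ℕ) :
    DependsOn (fun z => sgd γ N w₀ z t) (Set.Iio t) := by
  induction t with
  | zero => exact fun _ _ _ => rfl
  | succ t ih =>
    intro z z' h
    have hw : sgd γ N w₀ z t = sgd γ N w₀ z' t := ih fun r hr => h r (hr.trans t.lt_succ_self)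
    simp only [sgd, hw, h t t.lt_succ_self]

/-- The error `w_t - w*` of the SGD iterate after `t` steps on the samples `Z`. -/
noncomputable def sgdError (wstar : E) (γ : ℝ) (N : ℕ) (w₀ : E) (Z : ℕ → Ω → E × ℝ) (t : ℕ)
    (ω : Ω) : E :=
  sgd γ N w₀ (fun r => Z r ω) t - wstar

lemma sgdError_succ (Z : ℕ → Ω → E × ℝ) (t : ℕ) (ω : Ω) :
    sgdError wstar γ N w₀ Z (t + 1) ω =
      errorStep wstar (stepsize γ N t) (sgdError wstar γ N w₀ Z t ω) (Z t ω) := by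
  simp only [sgdError, errorStep, residual, sgd, inner_sub_left,
    real_inner_comm (sgd γ N w₀ (fun r => Z r ω) t)]
  module

variable [MeasurableSpace Ω] {P : Measure Ω} {Z : ℕ → Ω → E × ℝ}

lemma secondMoment_sgdError_zero [IsProbabilityMeasure P] (a : E) :
    secondMoment P a (sgdError wstar γ N w₀ Z 0) =
      ENNReal.ofReal (inner ℝ a (w₀ - wstar) ^ 2) := by
  simp only [secondMoment, sgdError, sgd, lintegral_const, measure_univ, mul_one]

variable [SecondCountableTopology E] [MeasurableSpace E] [BorelSpace E]

lemma measurable_sgd (γ : ℝ) (N : ℕ) (w₀ : E) (t : ℕ) :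
    Measurable fun z : ℕ → E × ℝ => sgd γ N w₀ z t := by
  induction t with
  | zero => exact measurable_const
  | succ t ih => simp only [sgd]; fun_prop

lemma measurable_errorStep (wstar : E) (g : ℝ) :
    Measurable fun q : E × E × ℝ => errorStep wstar g q.1 q.2 := by
  unfold errorStep residual
  fun_prop

variable {D : Measure (E × ℝ)}

namespace IIDSamples

lemma aemeasurable_sgdError (hZ : IIDSamples P D Z N) (ht : t ≤ N) :
    AEMeasurable (sgdError wstar γ N w₀ Z t) P := by
  induction t with
  | zero => exact aemeasurable_const (b := w₀ - wstar)
  | succ t ih =>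
    rw [funext (sgdError_succ Z t)]
    exact (measurable_errorStep wstar _).comp_aemeasurable
      ((ih (by omega)).prodMk (hZ.hasLaw t ht).aemeasurable)

lemma indepFun_sgdError (hZ : IIDSamples P D Z N) (ht : t < N) :
    IndepFun (sgdError wstar γ N w₀ Z t) (Z t) P :=
  indepFun_of_dependsOn_past ((measurable_sgd γ N w₀ t).sub_const wstar)
    (fun _ _ h => congrArg (· - wstar) (dependsOn_sgd γ N w₀ t h))
    (fun r hr => (hZ.hasLaw r hr).aemeasurable) hZ.iIndepFun ht

variable [IsProbabilityMeasure D]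

lemma expectedExcessRisk_eq [CompleteSpace E] {ι : Type*} {v : HilbertBasis ι ℝ E} {lam : ι → ℝ}
    (hZ : IIDSamples P D Z N) (hm : Model D wstar)
    (hv : ∀ i, cov D (v i) = lam i • v i) :
    expectedExcessRisk P D wstar γ N w₀ Z = ENNReal.ofReal (1 / 2) *
      ∑' i, ENNReal.ofReal (lam i) * secondMoment P (v i) (sgdError wstar γ N w₀ Z N) := by
  have hU : AEMeasurable (sgdError wstar γ N w₀ Z N) P := hZ.aemeasurable_sgdError le_rfl
  rw [← lintegral_quad hU hv (eigenvalue_nonneg hm.memLp_covariate_two hv), expectedExcessRisk]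
  simp only [hm.excessRisk_eq, ENNReal.ofReal_mul (by norm_num : (0 : ℝ) ≤ 1 / 2)]
  exact lintegral_const_mul'' _
    ((continuous_quad (cov D)).measurable.comp_aemeasurable hU).ennreal_ofReal

variable [IsProbabilityMeasure P]

lemma secondMoment_sgdError_succ (hZ : IIDSamples P D Z N) (ht : t < N) {a : E}
    (hx : MemLp (fun p : E × ℝ => p.1) 4 D)
    (hr : MemLp (fun p => residual wstar p * inner ℝ a p.1) 2 D) :
    secondMoment P a (sgdError wstar γ N w₀ Z (t + 1)) =
      ∫⁻ ω, ENNReal.ofReal (∫ p, inner ℝ a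
        (errorStep wstar (stepsize γ N t) (sgdError wstar γ N w₀ Z t ω) p) ^ 2 ∂D) ∂P := by
  have hmeas : Measurable fun q : E × E × ℝ =>
      ENNReal.ofReal (inner ℝ a (errorStep wstar (stepsize γ N t) q.1 q.2) ^ 2) :=
    ((measurable_const.inner (measurable_errorStep wstar _)).pow_const 2).ennreal_ofReal
  simp only [secondMoment, sgdError_succ]
  rw [lintegral_comp_prodMk_of_indepFun hmeas (hZ.aemeasurable_sgdError ht.le) (hZ.hasLaw t ht)
    (hZ.indepFun_sgdError ht)]
  exact lintegral_congr fun ω => (ofReal_integral_eq_lintegral_ofReal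
    (memLp_inner_errorStep hx hr _ _).integrable_sq
    (Filter.Eventually.of_forall fun p => sq_nonneg _)).symm

variable [CompleteSpace E] {ι : Type*} {v : HilbertBasis ι ℝ E} {lam : ι → ℝ} {σ : ℝ}

lemma momentUpperRecursion_secondMoment (hZ : IIDSamples P D Z N) (hm : Model D wstar)
    (hn : NoiseCondition D wstar σ) (hv : ∀ i, cov D (v i) = lam i • v i) {α : ℝ} (hα0 : 0 ≤ α)
    (hα : FourthMomentUpper D v α) :
    MomentUpperRecursion lam γ N α (σ ^ 2)
      fun t i => secondMoment P (v i) (sgdError wstar γ N w₀ Z t) := fun t ht i => by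
  beta_reduce
  have hl := eigenvalue_nonneg hm.memLp_covariate_two hv
  have hli := hl i
  rw [hZ.secondMoment_sgdError_succ ht hm.covariate (hn.memLp_residual_mul_inner hm (v i)),
    ← lintegral_inner_sq_add_quad (hZ.aemeasurable_sgdError ht.le) hv hl (v i) (sq_nonneg _)
      (by positivity) hα0 (sq_nonneg σ), ← quad_basis hv i]
  exact lintegral_mono fun ω => ENNReal.ofReal_le_ofReal
    (hn.integral_inner_errorStep_sq_le hm hα (quad_basis hv i ▸ hv i) _ _)

lemma lowerRecursion_secondMoment (hZ : IIDSamples P D Z N) (hm : Model D wstar)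
    (hw : WellSpecifiedNoise D wstar σ) (hv : ∀ i, cov D (v i) = lam i • v i) {β : ℝ}
    (hβ0 : 0 ≤ β) (hβ : FourthMomentLower D v β) :
    LowerRecursion lam γ N β (σ ^ 2)
      fun t i => secondMoment P (v i) (sgdError wstar γ N w₀ Z t) := fun t ht i => by
  beta_reduce
  have hl := eigenvalue_nonneg hm.memLp_covariate_two hv
  have hli := hl i
  rw [hZ.secondMoment_sgdError_succ ht hm.covariate (hw.memLp_residual_mul_inner hm (v i)),
    ← lintegral_inner_sq_add_quad (hZ.aemeasurable_sgdError ht.le) hv hl (v i) (sq_nonneg _)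
      (by positivity) hβ0 (sq_nonneg σ), ← quad_basis hv i]
  exact lintegral_mono fun ω => ENNReal.ofReal_le_ofReal
    (hw.le_integral_inner_errorStep_sq hm hβ (quad_basis hv i ▸ hv i) _ _)

end IIDSamples

end Dynamics

section Rates

variable {ι : Type*} {lam : ι → ℝ} {γ : ℝ} {N : ℕ}

lemma tsum_effDimWeights (K : Set ι) :
    ∑' i, ENNReal.ofReal (effDimWeights lam γ N K i) = effDim lam γ N K := by
  rw [effDim, ← ENNReal.tsum_set_one, ← ENNReal.tsum_mul_left,
    ← ENNReal.summable.tsum_add_tsum_compl (s := K) ENNReal.summable]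
  congr 1
  · exact tsum_congr fun i => by rw [effDimWeights_of_mem i.2, ENNReal.ofReal_one]
  · refine tsum_congr fun i => ?_
    rw [effDimWeights_of_notMem i.2, ← ENNReal.ofReal_mul (by positivity), ← mul_pow, ← mul_pow,
      mul_assoc]

lemma tsum_effDimWeights_div (hN : 1 < N) (K : Set ι) :
    ∑' i, ENNReal.ofReal (effDimWeights lam γ N K i / effN N) =
      effDim lam γ N K / ENNReal.ofReal (effN N) := by
  simp only [ENNReal.ofReal_div_of_pos (effN_pos hN)]
  simp only [div_eq_mul_inv]
  rw [ENNReal.tsum_mul_right, tsum_effDimWeights]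

variable {E : Type*} [NormedAddCommGroup E] [InnerProductSpace ℝ E] {v : HilbertBasis ι ℝ E}

lemma tsum_ofReal_inner_sq_ne_top (u : E) : ∑' i, ENNReal.ofReal (inner ℝ (v i) u ^ 2) ≠ ∞ :=
  tsum_ofReal_ne_top_of_summable (fun _ => sq_nonneg _)
    ((v.summable_inner_mul_inner u u).congr fun i => by rw [real_inner_comm u (v i), sq])

variable {A : E →L[ℝ] E}

lemma tsum_bias_add_variance (hN : 1 < N) (hv : ∀ i, A (v i) = lam i • v i) (hl : ∀ i, 0 ≤ lam i)
    (u : E) (K : Set ι) (B : ℝ≥0∞) :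
    ∑' i, (ENNReal.ofReal (lam i * decay γ N (lam i) 0 ^ 2) *
        ENNReal.ofReal (inner ℝ (v i) u ^ 2) +
      B * ENNReal.ofReal (effDimWeights lam γ N K i / effN N)) =
    ENNReal.ofReal (quad A (contraction A γ N u)) +
      B * (effDim lam γ N K / ENNReal.ofReal (effN N)) := by
  rw [ENNReal.tsum_add, ENNReal.tsum_mul_left, tsum_effDimWeights_div hN,
    ofReal_quad_eq_specNormSq hv hl, specNormSq]
  congr 1
  refine tsum_congr fun i => ?_
  rw [inner_basis_contraction hv, mul_pow, ← mul_assoc,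
    ENNReal.ofReal_mul (mul_nonneg (hl i) (sq_nonneg _))]

theorem upperRate_optSet_le (hv : ∀ i, A (v i) = lam i • v i) (hl : ∀ i, 0 ≤ lam i)
    {α β σ R : ℝ} (hα : 0 ≤ α) (hσ : 0 < σ) {u : E} (hR : quad A u ≤ R * σ ^ 2) :
    upperRate A v lam α σ γ N u (optSet lam γ N) ≤
      ENNReal.ofReal (1 + α * R) * lowerRate A v lam β σ γ N u (optSet lam γ N) := by
  have hquad : 0 ≤ quad A u :=
    (hasSum_quad hv u).nonneg fun i => mul_nonneg (hl i) (sq_nonneg _)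
  have hR0 : 0 ≤ R := nonneg_of_mul_nonneg_left (hquad.trans hR) (pow_pos hσ 2)
  have hweights : ∀ i, splitWeights lam (optSet lam γ N) (1 / (effN N * γ)) i ≤ lam i := fun i => by
    by_cases hi : i ∈ optSet lam γ N
    · rw [splitWeights_of_mem hi, mul_comm]
      exact hi
    · rw [splitWeights_of_notMem hi]
  have hspec : specNormSq v (splitWeights lam (optSet lam γ N) (1 / (effN N * γ))) u ≤
      ENNReal.ofReal (R * σ ^ 2) := by
    refine le_trans ?_ (ENNReal.ofReal_le_ofReal hR)
    rw [ofReal_quad_eq_specNormSq hv hl]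
    exact ENNReal.tsum_le_tsum fun i => ENNReal.ofReal_le_ofReal
      (mul_le_mul_of_nonneg_right (hweights i) (sq_nonneg _))
  have hsnr : ENNReal.ofReal α * ENNReal.ofReal (R * σ ^ 2) + ENNReal.ofReal (σ ^ 2) =
      ENNReal.ofReal (1 + α * R) * ENNReal.ofReal (σ ^ 2) := by
    rw [← ENNReal.ofReal_mul hα, ← ENNReal.ofReal_add (by positivity) (by positivity),
      ← ENNReal.ofReal_mul (by positivity)]
    congr 1
    ring
  rw [upperRate, lowerRate, mul_add, ← mul_assoc]
  gcongr
  · exact le_mul_of_one_le_left' (ENNReal.one_le_ofReal.2 (by nlinarith [mul_nonneg hα hR0]))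
  · calc _ ≤ ENNReal.ofReal α * ENNReal.ofReal (R * σ ^ 2) + ENNReal.ofReal (σ ^ 2) := by gcongr
      _ = ENNReal.ofReal (1 + α * R) * ENNReal.ofReal (σ ^ 2) := hsnr
      _ ≤ _ := by gcongr; exact le_add_self

end Rates

section ExcessRisk

variable {E : Type*} [NormedAddCommGroup E] [InnerProductSpace ℝ E] [CompleteSpace E]
  [MeasurableSpace E] {ι : Type*} {v : HilbertBasis ι ℝ E} {lam : ι → ℝ} {D : Measure (E × ℝ)}
  [IsProbabilityMeasure D] {wstar : E} {α γ : ℝ}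

lemma admissibleStepsize (hm : Model D wstar) (hv : ∀ i, cov D (v i) = lam i • v i)
    (hα : FourthMomentUpper D v α) (hγ : 0 < γ)
    (hγtr : γ < 1 / (4 * α * opTrace v (cov D))) : AdmissibleStepsize lam γ α := by
  have hl := eigenvalue_nonneg hm.memLp_covariate_two hv
  rw [opTrace_eq_tsum hv] at hγtr
  have htrace : 0 < 4 * α * ∑' i, lam i := one_div_pos.1 (hγ.trans hγtr)
  obtain ⟨i, hi⟩ : ∃ i, lam i ≠ 0 := by
    by_contra! hzero
    simp [hzero] at htrace
  refine ⟨hl, summable_eigenvalues hm.memLp_covariate_two hv, hγ,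
    hα.one_le hm.covariate (a := v i) ?_, ?_⟩
  · rw [quad_basis hv]
    exact (hl i).lt_of_ne' hi
  · rw [lt_div_iff₀ htrace] at hγtr
    linarith

variable [SecondCountableTopology E] [BorelSpace E] {w₀ : E} {Ω : Type*} [MeasurableSpace Ω]
  {P : Measure Ω} [IsProbabilityMeasure P] {N : ℕ} {Z : ℕ → Ω → E × ℝ} {σ : ℝ}

theorem expectedExcessRisk_le (hN : 1 < N) (hZ : IIDSamples P D Z N) (hm : Model D wstar)
    (hv : ∀ i, cov D (v i) = lam i • v i) (hα : FourthMomentUpper D v α)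
    (hn : NoiseCondition D wstar σ) (h : AdmissibleStepsize lam γ α) (K : Set ι) :
    expectedExcessRisk P D wstar γ N w₀ Z ≤
      ENNReal.ofReal 128 * upperRate (cov D) v lam α σ γ N (w₀ - wstar) K := by
  have hS := hZ.momentUpperRecursion_secondMoment (γ := γ) (w₀ := w₀) hm hn hv h.coeff_nonneg hα
  have hcoord := hS.coord_le hN h (sq_nonneg σ)
    (by simpa only [secondMoment_sgdError_zero] using tsum_ofReal_inner_sq_ne_top _) K
  have hweights : ∀ j, 0 ≤ splitWeights lam K (1 / (effN N * γ)) j := splitWeights_nonneg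
    h.eigenvalue_nonneg (one_div_nonneg.2 (mul_nonneg effN_nonneg h.pos.le))
  simp only [secondMoment_sgdError_zero, ← specNormSq_eq hweights, ← mul_assoc] at hcoord
  rw [hZ.expectedExcessRisk_eq hm hv]
  calc _ ≤ ∑' i, ENNReal.ofReal (lam i) * secondMoment P (v i) (sgdError wstar γ N w₀ Z N) :=
        mul_le_of_le_one_left' (ENNReal.ofReal_le_one.2 (by norm_num))
    _ ≤ _ := ENNReal.tsum_le_tsum hcoord
    _ = _ := tsum_bias_add_variance hN hv h.eigenvalue_nonneg _ K _
    _ ≤ _ := by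
        rw [upperRate, mul_add _ (ENNReal.ofReal (quad _ _)), ← mul_assoc]
        gcongr
        exact le_mul_of_one_le_left' (ENNReal.one_le_ofReal.2 (by norm_num))

theorem le_expectedExcessRisk (hN : 1 < N) (hZ : IIDSamples P D Z N) (hm : Model D wstar)
    (hv : ∀ i, cov D (v i) = lam i • v i) {β : ℝ} (hβ0 : 0 ≤ β) (hβ : FourthMomentLower D v β)
    (hw : WellSpecifiedNoise D wstar σ) (hγ : 0 < γ) (hγl : ∀ i, γ * lam i ≤ 1 / 4) :
    ENNReal.ofReal (Real.exp (-32) / 64) *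
        lowerRate (cov D) v lam β σ γ N (w₀ - wstar) (optSet lam γ N) ≤
      expectedExcessRisk P D wstar γ N w₀ Z := by
  have hl := eigenvalue_nonneg hm.memLp_covariate_two hv
  have hS := hZ.lowerRecursion_secondMoment (γ := γ) (w₀ := w₀) hm hw hv hβ0 hβ
  have hcoord := hS.le_coord hN hγ hl hγl
  simp only [secondMoment_sgdError_zero, ← specNormSq_eq (splitWeights_nonneg hl le_rfl),
    ← mul_assoc] at hcoord
  have hconst : ENNReal.ofReal (Real.exp (-32) / 64) =
      ENNReal.ofReal (1 / 2) * ENNReal.ofReal (Real.exp (-32) / 32) := by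
    rw [← ENNReal.ofReal_mul (by norm_num)]
    congr 1
    ring
  have hsmall : Real.exp (-32) / 32 ≤ 1 := by
    linarith [Real.exp_le_one_iff.2 (by norm_num : (-32 : ℝ) ≤ 0)]
  rw [hZ.expectedExcessRisk_eq hm hv, hconst, mul_assoc]
  gcongr
  calc _ ≤ _ := by
        rw [lowerRate, mul_add, ← mul_assoc]
        gcongr
        exact mul_le_of_le_one_left' (ENNReal.ofReal_le_one.2 hsmall)
    _ = _ := (tsum_bias_add_variance hN hv hl _ _ _).symm
    _ ≤ _ := ENNReal.tsum_le_tsum hcoord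

theorem corollary4_general (v : HilbertBasis ι ℝ E) (lam : ι → ℝ) (w₀ : E)
    (hm : Model D wstar) (hv : ∀ i, cov D (v i) = lam i • v i)
    (hupper : FourthMomentUpper D v α) (hσ : 0 < σ) (hn : NoiseCondition D wstar σ) (hN : 1 < N)
    (hlaw : ∀ t < N, HasLaw (Z t) D P) (hindep : iIndepFun (fun t : Fin N => Z t) P) (hγ : 0 < γ)
    (hγtr : γ < 1 / (4 * α * opTrace v (cov D))) :
    (∀ K : Set ι, expectedExcessRisk P D wstar γ N w₀ Z ≤
      ENNReal.ofReal 128 * upperRate (cov D) v lam α σ γ N (w₀ - wstar) K) ∧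
    ∀ β : ℝ, 0 < β → FourthMomentLower D v β → WellSpecifiedNoise D wstar σ →
      ENNReal.ofReal (Real.exp (-32) / 64) *
          lowerRate (cov D) v lam β σ γ N (w₀ - wstar) (optSet lam γ N) ≤
        expectedExcessRisk P D wstar γ N w₀ Z ∧
      ∀ R : ℝ, quad (cov D) (w₀ - wstar) ≤ R * σ ^ 2 →
        upperRate (cov D) v lam α σ γ N (w₀ - wstar) (optSet lam γ N) ≤
          ENNReal.ofReal (1 + α * R) *
            lowerRate (cov D) v lam β σ γ N (w₀ - wstar) (optSet lam γ N) :=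
  have hZ : IIDSamples P D Z N := ⟨hlaw, hindep⟩
  have h : AdmissibleStepsize lam γ α := admissibleStepsize hm hv hupper hγ hγtr
  ⟨expectedExcessRisk_le hN hZ hm hv hupper hn h, fun _ hβ hlower hw =>
    ⟨le_expectedExcessRisk hN hZ hm hv hβ.le hlower hw hγ h.mul_eigenvalue_le,
      fun _ hR => upperRate_optSet_le hv h.eigenvalue_nonneg h.coeff_nonneg hσ hR⟩⟩

end ExcessRisk

end TargetSGD

theorem corollary4 :
    ∃ C c : ℝ, 0 < C ∧ 0 < c ∧
      ∀ (E : Type*) [NormedAddCommGroup E] [InnerProductSpace ℝ E] [CompleteSpace E]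
        [SecondCountableTopology E] [MeasurableSpace E] [BorelSpace E]
        (ι : Type*) (v : HilbertBasis ι ℝ E) (lam : ι → ℝ)
        (D : Measure (E × ℝ)) [IsProbabilityMeasure D] (wstar : E)
        (Ω : Type*) [MeasurableSpace Ω] (P : Measure Ω) [IsProbabilityMeasure P]
        (N : ℕ) (Z : ℕ → Ω → E × ℝ) (w₀ : E) (α σ γ : ℝ),
        TargetSGD.Model D wstar →
        (∀ i, TargetSGD.cov D (v i) = lam i • v i) →
        0 < α → TargetSGD.FourthMomentUpper D v α →
        0 < σ → TargetSGD.NoiseCondition D wstar σ →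
        100 < N →
        (∀ t < N, HasLaw (Z t) D P) → iIndepFun (fun t : Fin N => Z t) P →
        0 < γ → γ < 1 / (4 * α * TargetSGD.opTrace v (TargetSGD.cov D)) →
        (∀ K : Set ι,
          TargetSGD.expectedExcessRisk P D wstar γ N w₀ Z ≤
            ENNReal.ofReal C *
              TargetSGD.upperRate (TargetSGD.cov D) v lam α σ γ N (w₀ - wstar) K) ∧
        (∀ β : ℝ, 0 < β → TargetSGD.FourthMomentLower D v β →
          TargetSGD.WellSpecifiedNoise D wstar σ →
          ENNReal.ofReal c *
              TargetSGD.lowerRate (TargetSGD.cov D) v lam β σ γ N (w₀ - wstar)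
                (TargetSGD.optSet lam γ N) ≤
            TargetSGD.expectedExcessRisk P D wstar γ N w₀ Z ∧
          ∀ R : ℝ, TargetSGD.quad (TargetSGD.cov D) (w₀ - wstar) ≤ R * σ ^ 2 →
            TargetSGD.upperRate (TargetSGD.cov D) v lam α σ γ N (w₀ - wstar)
                (TargetSGD.optSet lam γ N) ≤
              ENNReal.ofReal (1 + α * R) *
                TargetSGD.lowerRate (TargetSGD.cov D) v lam β σ γ N (w₀ - wstar)
                  (TargetSGD.optSet lam γ N)) := by
  refine ⟨128, Real.exp (-32) / 64, by norm_num, by positivity, ?_⟩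
  intro E _ _ _ _ _ _ ι v lam D _ wstar Ω _ P _ N Z w₀ α σ γ hm hv _ hupper hσ hn hN
  exact TargetSGD.corollary4_general v lam w₀ hm hv hupper hσ hn (by omega)
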